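/- Let $\mathbb T^d=(\mathbb R/2\pi\mathbb Z)^d$, $\sigma>0$, $V\in C^2(\mathbb T^d)$ and $W\in W^{2,\infty}(\mathbb T^d)$ be real-valued with $W$ even. Write $(f*g)(x)=\int_{\mathbb T^d}f(x-x')g(x')\,dx'$ and $v[\mu]=V+W*\mu$. Let $\bar\mu\in H^1(\mathbb T^d)$ be a stationary state of the McKean–Vlasov equation $\partial_t\mu=\sigma\Delta\mu+\nabla\cdot(\mu\nabla v[\mu])$, i.e. $\bar\mu\ge 0$, $\int_{\mathbb T^d}\bar\mu\,dx=1$ and $$\int_{\mathbb T^d}\bigl(\sigma\nabla\bar\mu+\bar\mu\nabla v[\bar\mu]\bigr)\cdot\nabla\varphi\,dx=0\qquad\text{for all }\varphi\in H^1(\mathbb T^d).$$ Let $\mathcal X=L^2(\mathbb T^d,\bar\mu^{-1})$ be the complex Hilbert space with norm $\|y\|^2=\int_{\mathbb T^d}|y|^2\bar\mu^{-1}\,dx$, and let $\mathcal L$ be the McKean–Vlasov operator linearized at $\bar\mu$, that is, the unbounded operator on $\mathcal X$ with domain $H^2(\mathbb T^d)$ given by $$\mathcal L y=\nabla\cdot(\sigma\nabla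 y+y\nabla V)+\nabla\cdot\bigl(y\,(\nabla W*\bar\mu)+\bar\mu\,(\nabla W*y)\bigr).$$ Let $\sigma(\mathcal L)\subset\mathbb C$ be its spectrum, i.e. the set of $\lambda\in\mathbb C$ for which $\lambda I-\mathcal L$ has no bounded inverse defined on all of $\mathcal X$. Then for every $\delta>0$ the set $$\{\lambda\in\sigma(\mathcal L):\operatorname{Re}\lambda\ge-\delta\}$$ is finite. -/

import Mathlib

open MeasureTheory Filter
open scoped ENNReal ContDiff

namespace McKeanVlasov

instance instFactTwoPi : Fact (0 < 2 * Real.pi) := ⟨Real.two_pi_pos⟩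

/-- The torus `(ℝ / 2πℤ)^d`, with its Lebesgue measure of total mass `(2π)^d`. -/
abbrev Torus (d : ℕ) : Type := Fin d → AddCircle (2 * Real.pi)

/-- The covering map `ℝ^d → 𝕋^d`. -/
noncomputable def cover {d : ℕ} (x : Fin d → ℝ) : Torus d := fun i => (x i : AddCircle (2 * Real.pi))

/-- `f ∈ C^n(𝕋^d)`: the periodic lift of `f` to `ℝ^d` is `C^n`. -/
def IsCn {d : ℕ} (n : WithTop ℕ∞) (f : Torus d → ℝ) : Prop :=
  ContDiff ℝ n (fun x : Fin d → ℝ => f (cover x))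

/-- The classical partial derivative `∂_i f` on the torus. -/
noncomputable def torusPartial {d : ℕ} (i : Fin d) (f : Torus d → ℝ) (t : Torus d) : ℝ :=
  deriv (fun s : ℝ => f (t + Pi.single i (s : AddCircle (2 * Real.pi)))) 0

section Weak

variable {d : ℕ} {E : Type*} [NormedAddCommGroup E] [NormedSpace ℝ E]

/-- `f = ∇ · F` in the weak sense: `∫ f φ = - ∫ F · ∇φ` for all smooth `φ` on the torus. -/
def HasWeakDiv (F : Fin d → Torus d → E) (f : Torus d → E) : Prop :=
  (∀ i, Integrable (F i)) ∧ Integrable f ∧ ∀ φ : Torus d → ℝ, IsCn ∞ φ →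
    ∫ x, φ x • f x = - ∫ x, ∑ i, torusPartial i φ x • F i x

/-- `g = ∂_i f` in the weak sense: `∫ g φ = - ∫ f ∂_i φ` for all smooth `φ` on the torus. -/
def HasWeakPartial (i : Fin d) (f g : Torus d → E) : Prop :=
  Integrable f ∧ Integrable g ∧ ∀ φ : Torus d → ℝ, IsCn ∞ φ →
    ∫ x, φ x • g x = - ∫ x, torusPartial i φ x • f x

open Classical in
/-- The weak partial derivative `∂_i f` (unique almost everywhere; zero if there is none). -/
noncomputable def weakPartial (i : Fin d) (f : Torus d → E) : Torus d → E :=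
  if h : ∃ g, HasWeakPartial i f g then h.choose else 0

/-- `f ∈ W^{k,p}(𝕋^d)`: all weak derivatives of `f` up to order `k` exist and lie in `L^p`. -/
def MemSobolev : ℕ → ℝ≥0∞ → (Torus d → E) → Prop
  | 0, p, f => MemLp f p volume
  | k + 1, p, f => MemLp f p volume ∧ ∀ i, ∃ g, HasWeakPartial i f g ∧ MemSobolev k p g

/-- The periodic convolution `(f * g)(x) = ∫ f(t) g(x - t) dt = ∫ f(x - t) g(t) dt`. -/
noncomputable def torusConv (f : Torus d → ℝ) (g : Torus d → E) : Torus d → E :=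
  convolution f g (ContinuousLinearMap.lsmul ℝ ℝ) volume

end Weak

/-- The `i`-th component of `∇v[μ] = ∇V + ∇W * μ`. -/
noncomputable def gradPotential {d : ℕ} (V W μ : Torus d → ℝ) (i : Fin d) (x : Torus d) : ℝ :=
  torusPartial i V x + torusConv (weakPartial i W) μ x

/-- `μbar` is a stationary state of `∂_t μ = ∇ · (σ ∇μ + μ ∇v[μ])`, i.e. a probability density in
`H¹(𝕋^d)` that is a time-independent variational solution. -/
structure IsStationaryState {d : ℕ} (σ : ℝ) (V W μbar : Torus d → ℝ) : Prop where
  memSobolev : MemSobolev 1 2 μbar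
  nonneg : ∀ᵐ x, 0 ≤ μbar x
  integral_eq_one : ∫ x, μbar x = 1
  weak_eq : ∀ φ : Torus d → ℝ, MemSobolev 1 2 φ →
    ∫ x, ∑ i, (σ * weakPartial i μbar x + μbar x * gradPotential V W μbar i x) *
      weakPartial i φ x = 0

/-- The measure `μbar(x)⁻¹ dx`. -/
noncomputable def weightedMeasure {d : ℕ} (μbar : Torus d → ℝ) : Measure (Torus d) :=
  volume.withDensity (fun x => (ENNReal.ofReal (μbar x))⁻¹)

/-- The complex Hilbert space `𝒳 = L²(𝕋^d, μbar⁻¹)`. -/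
abbrev WeightedL2 {d : ℕ} (μbar : Torus d → ℝ) : Type := Lp ℂ 2 (weightedMeasure μbar)

/-- The vector field `σ ∇y + y ∇v[μbar] + μbar (∇W * y)
  = (σ ∇y + y ∇V) + (y (∇W * μbar) + μbar (∇W * y))`,
whose divergence is `𝓛 y = 𝓐 y + 𝓓_W y`. -/
noncomputable def linearizedFlux {d : ℕ} (σ : ℝ) (V W μbar : Torus d → ℝ) (y : Torus d → ℂ)
    (i : Fin d) (x : Torus d) : ℂ :=
  σ • weakPartial i y x + gradPotential V W μbar i x • y x
    + μbar x • torusConv (weakPartial i W) y x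

/-! ### Smooth functions and uniqueness of weak derivatives -/

section Aux

variable {d : ℕ}

lemma isOpenQuotientMap_cover : IsOpenQuotientMap (cover : (Fin d → ℝ) → Torus d) := by
  have : (cover : (Fin d → ℝ) → Torus d)
      = Pi.map (fun _ => ((↑) : ℝ → AddCircle (2 * Real.pi))) := rfl
  rw [this]
  exact IsOpenQuotientMap.piMap fun _ => QuotientAddGroup.isOpenQuotientMap_mk

lemma continuous_of_cover {f : Torus d → ℝ} (h : Continuous fun x => f (cover x)) :
    Continuous f :=
  isOpenQuotientMap_cover.isQuotientMap.continuous_iff.2 h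

lemma IsCn.continuous {n : WithTop ℕ∞} {f : Torus d → ℝ} (h : IsCn n f) : Continuous f :=
  continuous_of_cover (ContDiff.continuous h)

lemma torusPartial_cover {n : WithTop ℕ∞} (hn : 1 ≤ n) {f : Torus d → ℝ} (h : IsCn n f)
    (i : Fin d) (x : Fin d → ℝ) :
    torusPartial i f (cover x)
      = fderiv ℝ (fun x : Fin d → ℝ => f (cover x)) x (Pi.single i 1) := by
  have hd : DifferentiableAt ℝ (fun x : Fin d → ℝ => f (cover x)) x :=
    (ContDiff.differentiable h (by positivity)) x
  have e : (fun s : ℝ => f (cover x + Pi.single i (s : AddCircle (2 * Real.pi))))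
      = fun s : ℝ => (fun x : Fin d → ℝ => f (cover x)) (x + s • Pi.single i 1) := by
    funext s
    congr 1
    funext j
    by_cases hj : j = i
    · subst hj; simp [cover]
    · simp [cover, hj]
  rw [torusPartial, e]
  exact hd.lineDeriv_eq_fderiv

lemma IsCn.continuous_torusPartial {n : WithTop ℕ∞} (hn : 1 ≤ n) {f : Torus d → ℝ}
    (h : IsCn n f) (i : Fin d) : Continuous (torusPartial i f) := by
  apply continuous_of_cover
  simp_rw [torusPartial_cover hn h]
  exact (ContDiff.continuous_fderiv h (by positivity)).clm_apply continuous_const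

variable {E : Type*} [NormedAddCommGroup E] [NormedSpace ℝ E]

lemma integrable_smul_of_continuous {φ : Torus d → ℝ} (hφ : Continuous φ) {f : Torus d → E}
    (hf : Integrable f) : Integrable fun x => φ x • f x := by
  obtain ⟨C, hC⟩ := isCompact_univ.exists_bound_of_continuousOn (f := φ) hφ.continuousOn
  exact hf.bdd_smul C hφ.aestronglyMeasurable
    (Eventually.of_forall fun x => hC x (Set.mem_univ x))

/-- The algebra of smooth functions on the torus. -/
def smoothAlg (d : ℕ) : Subalgebra ℝ C(Torus d, ℝ) where
  carrier := {f | IsCn ∞ f}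
  mul_mem' := fun {a b} ha hb => by
    have ha : ContDiff ℝ ∞ fun x => a (cover x) := ha
    exact ha.mul hb
  add_mem' := fun {a b} ha hb => by
    have ha : ContDiff ℝ ∞ fun x => a (cover x) := ha
    exact ha.add hb
  algebraMap_mem' := fun r => by
    have : ContDiff ℝ ∞ fun _ : Fin d → ℝ => r := contDiff_const
    exact this

lemma smoothAlg_separatesPoints : (smoothAlg d).SeparatesPoints := by
  intro x y hxy
  obtain ⟨i, hi⟩ := Function.ne_iff.1 hxy
  have hcirc : (AddCircle.toCircle (x i) : ℂ) ≠ AddCircle.toCircle (y i) := fun h =>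
    hi (AddCircle.injective_toCircle Real.two_pi_pos.ne' (Subtype.ext h))
  have hc : Continuous fun t : Torus d => (AddCircle.toCircle (t i) : ℂ) :=
    continuous_subtype_val.comp (AddCircle.continuous_toCircle.comp (continuous_apply i))
  have key : ContDiff ℝ ∞ fun t : Fin d → ℝ => (AddCircle.toCircle (cover t i) : ℂ) := by
    have : (fun t : Fin d → ℝ => (AddCircle.toCircle (cover t i) : ℂ))
        = fun t => Complex.exp ((((2 * Real.pi) / (2 * Real.pi) * t i : ℝ) : ℂ) * Complex.I) := by
      funext t
      rw [cover, AddCircle.toCircle_apply_mk, Circle.coe_exp]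
    rw [this]
    apply ContDiff.cexp
    apply ContDiff.mul _ contDiff_const
    exact Complex.ofRealCLM.contDiff.comp (contDiff_const.mul (contDiff_apply ℝ ℝ i))
  by_cases hre : (AddCircle.toCircle (x i) : ℂ).re = (AddCircle.toCircle (y i) : ℂ).re
  · refine ⟨_, ⟨⟨fun t => (AddCircle.toCircle (t i) : ℂ).im, Complex.continuous_im.comp hc⟩, ?_,
      rfl⟩, fun h => hcirc (Complex.ext hre h)⟩
    exact Complex.imCLM.contDiff.comp key
  · refine ⟨_, ⟨⟨fun t => (AddCircle.toCircle (t i) : ℂ).re, Complex.continuous_re.comp hc⟩, ?_,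
      rfl⟩, hre⟩
    exact Complex.reCLM.contDiff.comp key

lemma integral_continuous_smul_eq_zero {f : Torus d → E} (hf : Integrable f)
    (h : ∀ φ : Torus d → ℝ, IsCn ∞ φ → ∫ x, φ x • f x = 0) (φ : C(Torus d, ℝ)) :
    ∫ x, φ x • f x = 0 := by
  have hcont : Continuous fun φ : C(Torus d, ℝ) => ∫ x, φ x • f x := by
    refine continuous_iff_continuousAt.2 fun φ₀ => ?_
    rw [ContinuousAt, tendsto_iff_norm_sub_tendsto_zero]
    have hb : ∀ φ : C(Torus d, ℝ),
        ‖(∫ x, φ x • f x) - ∫ x, φ₀ x • f x‖ ≤ ‖φ - φ₀‖ * ∫ x, ‖f x‖ := by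
      intro φ
      rw [← integral_sub (integrable_smul_of_continuous φ.continuous hf)
        (integrable_smul_of_continuous φ₀.continuous hf), ← integral_const_mul]
      refine norm_integral_le_of_norm_le (hf.norm.const_mul _) (Eventually.of_forall fun x => ?_)
      rw [← sub_smul, norm_smul]
      gcongr
      exact (φ - φ₀).norm_coe_le_norm x
    refine squeeze_zero (fun _ => norm_nonneg _) hb ?_
    have : Tendsto (fun φ : C(Torus d, ℝ) => ‖φ - φ₀‖ * ∫ x, ‖f x‖) (nhds φ₀)
        (nhds (‖φ₀ - φ₀‖ * ∫ x, ‖f x‖)) :=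
      (by fun_prop : Continuous fun φ : C(Torus d, ℝ) => ‖φ - φ₀‖ * ∫ x, ‖f x‖).tendsto φ₀
    simpa using this
  have hcl : IsClosed {φ : C(Torus d, ℝ) | ∫ x, φ x • f x = 0} :=
    isClosed_singleton.preimage hcont
  have hsub : closure (smoothAlg d : Set C(Torus d, ℝ)) ⊆ {φ | ∫ x, φ x • f x = 0} :=
    closure_minimal (fun φ hφ => h φ hφ) hcl
  have htop := ContinuousMap.subalgebra_topologicalClosure_eq_top_of_separatesPoints _
    (smoothAlg_separatesPoints (d := d))
  apply hsub
  rw [← Subalgebra.topologicalClosure_coe, htop]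
  trivial

/-- An integrable function that integrates to zero against all smooth functions vanishes. -/
lemma ae_eq_zero_of_forall_smooth [CompleteSpace E] {f : Torus d → E} (hf : Integrable f)
    (h : ∀ φ : Torus d → ℝ, IsCn ∞ φ → ∫ x, φ x • f x = 0) : f =ᵐ[volume] 0 := by
  refine ae_eq_zero_of_forall_setIntegral_isClosed_eq_zero hf fun s hs => ?_
  have hpos : ∀ n : ℕ, (0 : ℝ) < 1 / ((n : ℝ) + 1) := fun n => Nat.one_div_pos_of_nat
  have hδ : Tendsto (fun n : ℕ => 1 / ((n : ℝ) + 1)) atTop (nhds 0) :=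
    tendsto_one_div_add_atTop_nhds_zero_nat
  have hlim := thickenedIndicator_tendsto_indicator_closure hpos hδ s
  rw [hs.closure_eq] at hlim
  have hlim' := tendsto_pi_nhds.1 hlim
  have hz : ∀ n : ℕ, ∫ x, (thickenedIndicator (hpos n) s x : ℝ) • f x = 0 := fun n =>
    integral_continuous_smul_eq_zero hf h
      ⟨fun x => (thickenedIndicator (hpos n) s x : ℝ), by fun_prop⟩
  have hconv : Tendsto (fun n : ℕ => ∫ x, (thickenedIndicator (hpos n) s x : ℝ) • f x) atTop
      (nhds (∫ x, s.indicator f x)) := by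
    refine tendsto_integral_of_dominated_convergence (fun x => ‖f x‖) (fun n => ?_) hf.norm
      (fun n => Eventually.of_forall fun x => ?_) (Eventually.of_forall fun x => ?_)
    · exact (Continuous.aestronglyMeasurable (by fun_prop)).smul hf.aestronglyMeasurable
    · rw [norm_smul]
      have h1 : ‖((thickenedIndicator (hpos n) s x : NNReal) : ℝ)‖ ≤ 1 := by
        rw [Real.norm_of_nonneg NNReal.zero_le_coe]
        exact_mod_cast thickenedIndicator_le_one (hpos n) s x
      calc _ ≤ 1 * ‖f x‖ := by gcongr
        _ = ‖f x‖ := one_mul _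
    · have h2 := (NNReal.tendsto_coe.2 (hlim' x)).smul_const (f x)
      have h3 : (((s.indicator (fun _ => (1 : NNReal)) x : NNReal) : ℝ) • f x)
          = s.indicator f x := by
        by_cases hx : x ∈ s <;> simp [hx]
      rw [← h3]
      exact h2
  rw [← integral_indicator hs.measurableSet]
  simp_rw [hz] at hconv
  exact tendsto_nhds_unique hconv tendsto_const_nhds

lemma HasWeakDiv.unique [CompleteSpace E] {F : Fin d → Torus d → E} {f g : Torus d → E}
    (hf : HasWeakDiv F f) (hg : HasWeakDiv F g) : f =ᵐ[volume] g := by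
  have h : f - g =ᵐ[volume] 0 := by
    refine ae_eq_zero_of_forall_smooth (hf.2.1.sub hg.2.1) fun φ hφ => ?_
    simp_rw [Pi.sub_apply, smul_sub]
    rw [integral_sub (integrable_smul_of_continuous hφ.continuous hf.2.1)
      (integrable_smul_of_continuous hφ.continuous hg.2.1), hf.2.2 φ hφ, hg.2.2 φ hφ, sub_self]
  exact (sub_ae_eq_zero _ _).1 h

lemma HasWeakPartial.unique [CompleteSpace E] {i : Fin d} {f g g' : Torus d → E}
    (h : HasWeakPartial i f g) (h' : HasWeakPartial i f g') : g =ᵐ[volume] g' := by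
  have H : g - g' =ᵐ[volume] 0 := by
    refine ae_eq_zero_of_forall_smooth (h.2.1.sub h'.2.1) fun φ hφ => ?_
    simp_rw [Pi.sub_apply, smul_sub]
    rw [integral_sub (integrable_smul_of_continuous hφ.continuous h.2.1)
      (integrable_smul_of_continuous hφ.continuous h'.2.1), h.2.2 φ hφ, h'.2.2 φ hφ, sub_self]
  exact (sub_ae_eq_zero _ _).1 H

lemma weakPartial_spec {i : Fin d} {f g : Torus d → E} (h : HasWeakPartial i f g) :
    HasWeakPartial i f (weakPartial i f) := by
  have h' : ∃ g, HasWeakPartial i f g := ⟨g, h⟩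
  rw [weakPartial, dif_pos h']
  exact h'.choose_spec

lemma weakPartial_ae_eq [CompleteSpace E] {i : Fin d} {f g : Torus d → E}
    (h : HasWeakPartial i f g) : weakPartial i f =ᵐ[volume] g :=
  (weakPartial_spec h).unique h

lemma HasWeakPartial.congr {i : Fin d} {f f' g : Torus d → E} (h : HasWeakPartial i f g)
    (hf : f =ᵐ[volume] f') : HasWeakPartial i f' g := by
  refine ⟨h.1.congr hf, h.2.1, fun φ hφ => ?_⟩
  rw [h.2.2 φ hφ]
  congr 1
  refine integral_congr_ae ?_
  filter_upwards [hf] with x hx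
  rw [hx]

lemma HasWeakPartial.add {i : Fin d} {f f' g g' : Torus d → E} (h : HasWeakPartial i f g)
    (h' : HasWeakPartial i f' g') : HasWeakPartial i (f + f') (g + g') := by
  refine ⟨h.1.add h'.1, h.2.1.add h'.2.1, fun φ hφ => ?_⟩
  have hc := hφ.continuous_torusPartial (by norm_num) i
  simp_rw [Pi.add_apply, smul_add]
  rw [integral_add (integrable_smul_of_continuous hφ.continuous h.2.1)
      (integrable_smul_of_continuous hφ.continuous h'.2.1),
    integral_add (integrable_smul_of_continuous hc h.1) (integrable_smul_of_continuous hc h'.1),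
    h.2.2 φ hφ, h'.2.2 φ hφ, neg_add]

lemma HasWeakPartial.const_smul {i : Fin d} {f g : Torus d → ℂ} (h : HasWeakPartial i f g)
    (c : ℂ) : HasWeakPartial i (c • f) (c • g) := by
  refine ⟨h.1.smul c, h.2.1.smul c, fun φ hφ => ?_⟩
  simp_rw [Pi.smul_apply, smul_comm _ c]
  rw [integral_smul, integral_smul, h.2.2 φ hφ, smul_neg]

lemma MemSobolev.memLp {k : ℕ} {p : ℝ≥0∞} {f : Torus d → E} (h : MemSobolev k p f) :
    MemLp f p volume := by
  cases k with
  | zero => exact h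
  | succ k => exact h.1

lemma MemSobolev.congr {k : ℕ} {p : ℝ≥0∞} {f f' : Torus d → E} (h : MemSobolev k p f)
    (hf : f =ᵐ[volume] f') : MemSobolev k p f' := by
  cases k with
  | zero => exact MemLp.ae_eq hf h
  | succ k =>
    refine ⟨h.1.ae_eq hf, fun i => ?_⟩
    obtain ⟨g, hg, hg'⟩ := h.2 i
    exact ⟨g, hg.congr hf, hg'⟩

lemma MemSobolev.add {k : ℕ} {p : ℝ≥0∞} {f f' : Torus d → E} (h : MemSobolev k p f)
    (h' : MemSobolev k p f') : MemSobolev k p (f + f') := by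
  induction k generalizing f f' with
  | zero => exact MemLp.add h h'
  | succ k ih =>
    refine ⟨h.1.add h'.1, fun i => ?_⟩
    obtain ⟨g, hg, hgk⟩ := h.2 i
    obtain ⟨g', hg', hgk'⟩ := h'.2 i
    exact ⟨g + g', hg.add hg', ih hgk hgk'⟩

lemma MemSobolev.const_smul {k : ℕ} {p : ℝ≥0∞} {f : Torus d → ℂ} (h : MemSobolev k p f)
    (c : ℂ) : MemSobolev k p (c • f) := by
  induction k generalizing f with
  | zero => exact MemLp.const_smul h c
  | succ k ih =>
    refine ⟨h.1.const_smul c, fun i => ?_⟩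
    obtain ⟨g, hg, hgk⟩ := h.2 i
    exact ⟨c • g, hg.const_smul c, ih hgk⟩

lemma MemSobolev.memLp_weakPartial [CompleteSpace E] {k : ℕ} {p : ℝ≥0∞} {f : Torus d → E}
    (h : MemSobolev (k + 1) p f) (i : Fin d) : MemLp (weakPartial i f) p volume := by
  obtain ⟨g, hg, hgk⟩ := h.2 i
  exact hgk.memLp.ae_eq (weakPartial_ae_eq hg).symm

lemma MemSobolev.hasWeakPartial {k : ℕ} {p : ℝ≥0∞} {f : Torus d → E}
    (h : MemSobolev (k + 1) p f) (i : Fin d) : HasWeakPartial i f (weakPartial i f) := by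
  obtain ⟨g, hg, hgk⟩ := h.2 i
  exact weakPartial_spec hg

lemma HasWeakDiv.congr {F F' : Fin d → Torus d → E} {f f' : Torus d → E} (h : HasWeakDiv F f)
    (hF : ∀ i, F i =ᵐ[volume] F' i) (hf : f =ᵐ[volume] f') : HasWeakDiv F' f' := by
  refine ⟨fun i => (h.1 i).congr (hF i), h.2.1.congr hf, fun φ hφ => ?_⟩
  have e1 : ∫ x, φ x • f' x = ∫ x, φ x • f x := by
    refine integral_congr_ae ?_
    filter_upwards [hf] with x hx
    rw [hx]
  have e2 : ∫ x, ∑ i, torusPartial i φ x • F' i x = ∫ x, ∑ i, torusPartial i φ x • F i x := by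
    refine integral_congr_ae ?_
    filter_upwards [ae_all_iff.2 hF] with x hx
    simp_rw [hx]
  rw [e1, e2, h.2.2 φ hφ]

lemma HasWeakDiv.add {F F' : Fin d → Torus d → E} {f f' : Torus d → E} (h : HasWeakDiv F f)
    (h' : HasWeakDiv F' f') : HasWeakDiv (F + F') (f + f') := by
  refine ⟨fun i => (h.1 i).add (h'.1 i), h.2.1.add h'.2.1, fun φ hφ => ?_⟩
  have hc := fun i => hφ.continuous_torusPartial (by norm_num) i
  simp_rw [Pi.add_apply, smul_add, Finset.sum_add_distrib]
  rw [integral_add (integrable_smul_of_continuous hφ.continuous h.2.1)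
      (integrable_smul_of_continuous hφ.continuous h'.2.1),
    integral_add (integrable_finsetSum _ fun i _ => integrable_smul_of_continuous (hc i) (h.1 i))
      (integrable_finsetSum _ fun i _ => integrable_smul_of_continuous (hc i) (h'.1 i)),
    h.2.2 φ hφ, h'.2.2 φ hφ, neg_add]

lemma HasWeakDiv.const_smul {F : Fin d → Torus d → ℂ} {f : Torus d → ℂ} (h : HasWeakDiv F f)
    (c : ℂ) : HasWeakDiv (c • F) (c • f) := by
  refine ⟨fun i => (h.1 i).smul c, h.2.1.smul c, fun φ hφ => ?_⟩
  simp_rw [Pi.smul_apply, smul_comm _ c, ← Finset.smul_sum]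
  rw [integral_smul, integral_smul, h.2.2 φ hφ, smul_neg]

lemma convolutionExists_of_memLp_top {K : Torus d → ℝ} (hK : MemLp K ∞ volume)
    {y : Torus d → E} (hy : Integrable y) :
    ConvolutionExists K y (ContinuousLinearMap.lsmul ℝ ℝ) volume := by
  intro x
  have : (volume : Measure (Torus d)).IsAddHaarMeasure := by
    rw [volume_pi]; infer_instance
  have : (volume : Measure (Torus d)).Regular := inferInstance
  have h1 : Integrable fun t => y (x - t) := hy.comp_sub_left x
  exact h1.smul_of_top_right hK

/-! ### The linearized operator -/

variable {σ : ℝ} {V W μbar : Torus d → ℝ}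

lemma linearizedFlux_congr {y y' : Torus d → ℂ} (hy : MemSobolev 1 2 y) (h : y =ᵐ[volume] y')
    (i : Fin d) :
    linearizedFlux σ V W μbar y i =ᵐ[volume] linearizedFlux σ V W μbar y' i := by
  have h1 := weakPartial_ae_eq ((hy.hasWeakPartial i).congr h)
  have h2 : torusConv (weakPartial i W) y = torusConv (weakPartial i W) y' :=
    convolution_congr _ (ae_eq_refl _) h
  filter_upwards [h, h1] with x hx hx'
  simp only [linearizedFlux, h2, hx, hx']

lemma linearizedFlux_add (hW : MemSobolev 2 ∞ W) {y y' : Torus d → ℂ} (hy : MemSobolev 1 2 y)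
    (hy' : MemSobolev 1 2 y') (i : Fin d) :
    linearizedFlux σ V W μbar (y + y') i
      =ᵐ[volume] linearizedFlux σ V W μbar y i + linearizedFlux σ V W μbar y' i := by
  have h1 := weakPartial_ae_eq ((hy.hasWeakPartial i).add (hy'.hasWeakPartial i))
  have hK := hW.memLp_weakPartial i
  have h2 : torusConv (weakPartial i W) (y + y')
      = torusConv (weakPartial i W) y + torusConv (weakPartial i W) y' :=
    (convolutionExists_of_memLp_top hK (hy.hasWeakPartial i).1).distrib_add
      (convolutionExists_of_memLp_top hK (hy'.hasWeakPartial i).1)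
  filter_upwards [h1] with x hx
  simp only [linearizedFlux, h2, hx, Pi.add_apply, smul_add]
  abel

lemma linearizedFlux_smul {y : Torus d → ℂ} (hy : MemSobolev 1 2 y) (c : ℂ) (i : Fin d) :
    linearizedFlux σ V W μbar (c • y) i =ᵐ[volume] c • linearizedFlux σ V W μbar y i := by
  have h1 := weakPartial_ae_eq ((hy.hasWeakPartial i).const_smul c)
  have h2 : torusConv (weakPartial i W) (c • y) = c • torusConv (weakPartial i W) y := by
    funext x
    simp only [torusConv, convolution_def, ContinuousLinearMap.lsmul_apply, Pi.smul_apply,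
      smul_comm _ c]
    exact integral_smul _ _
  filter_upwards [h1] with x hx
  simp only [linearizedFlux, h2, hx, Pi.smul_apply, smul_add, smul_comm c]

lemma MemSobolev.of_succ {k : ℕ} {p : ℝ≥0∞} {f : Torus d → E} (h : MemSobolev (k + 1) p f) :
    MemSobolev k p f := by
  induction k generalizing f with
  | zero => exact h.1
  | succ k ih =>
    refine ⟨h.1, fun i => ?_⟩
    obtain ⟨g, hg, hgk⟩ := h.2 i
    exact ⟨g, hg, ih hgk⟩

lemma volume_absolutelyContinuous (hμ : IsStationaryState σ V W μbar) :
    (volume : Measure (Torus d)) ≪ weightedMeasure μbar := by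
  refine withDensity_absolutelyContinuous' ?_ (Eventually.of_forall fun x => ?_)
  · exact hμ.memSobolev.memLp.aestronglyMeasurable.aemeasurable.ennreal_ofReal.inv
  · exact ENNReal.inv_ne_zero.2 ENNReal.ofReal_ne_top

/-- The graph of `𝓛`: pairs `(y, f)` in `𝒳 × 𝒳` with `y ∈ H²(𝕋^d)` and
`f = ∇ · (σ ∇y + y ∇v[μbar] + μbar (∇W * y))`. -/
noncomputable def linearizedGraph (σ : ℝ) (V W μbar : Torus d → ℝ) (hW : MemSobolev 2 ∞ W)
    (hμ : IsStationaryState σ V W μbar) :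
    Submodule ℂ (WeightedL2 μbar × WeightedL2 μbar) where
  carrier := {p | MemSobolev 2 2 (p.1 : Torus d → ℂ) ∧
    HasWeakDiv (linearizedFlux σ V W μbar (p.1 : Torus d → ℂ)) (p.2 : Torus d → ℂ)}
  zero_mem' := by
    have h0 : (0 : Torus d → ℂ) =ᵐ[volume] ((0 : WeightedL2 μbar) : Torus d → ℂ) :=
      (volume_absolutelyContinuous hμ).ae_eq (Lp.coeFn_zero ℂ 2 _).symm
    have hz : ∀ k, MemSobolev k 2 (0 : Torus d → ℂ) := by
      intro k
      induction k with
      | zero => exact MemLp.zero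
      | succ k ih =>
        exact ⟨MemLp.zero, fun i => ⟨0, ⟨integrable_zero _ _ _, integrable_zero _ _ _,
          fun φ _ => by simp⟩, ih⟩⟩
    have hdiv : HasWeakDiv (0 : Fin d → Torus d → ℂ) 0 :=
      ⟨fun i => integrable_zero _ _ _, integrable_zero _ _ _, fun φ _ => by simp⟩
    refine ⟨(hz 2).congr h0, hdiv.congr (fun i => ?_) h0⟩
    have h1 := linearizedFlux_smul (σ := σ) (V := V) (W := W) (μbar := μbar) (hz 1) 0 i
    rw [zero_smul, zero_smul] at h1
    exact h1.symm.trans (linearizedFlux_congr (hz 1) h0 i)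
  add_mem' := by
    rintro ⟨y, f⟩ ⟨y', f'⟩ ⟨hy, hf⟩ ⟨hy', hf'⟩
    have e1 := (volume_absolutelyContinuous hμ).ae_eq (Lp.coeFn_add y y').symm
    have e2 := (volume_absolutelyContinuous hμ).ae_eq (Lp.coeFn_add f f').symm
    exact ⟨(hy.add hy').congr e1, (hf.add hf').congr (fun i =>
      (linearizedFlux_add hW hy.of_succ hy'.of_succ i).symm.trans
        (linearizedFlux_congr (hy.of_succ.add hy'.of_succ) e1 i)) e2⟩
  smul_mem' := by
    rintro c ⟨y, f⟩ ⟨hy, hf⟩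
    have e1 := (volume_absolutelyContinuous hμ).ae_eq (Lp.coeFn_smul c y).symm
    have e2 := (volume_absolutelyContinuous hμ).ae_eq (Lp.coeFn_smul c f).symm
    exact ⟨(hy.const_smul c).congr e1, (hf.const_smul c).congr (fun i =>
      (linearizedFlux_smul hy.of_succ c i).symm.trans
        (linearizedFlux_congr (hy.of_succ.const_smul c) e1 i)) e2⟩

lemma linearizedGraph_snd_eq_zero (hW : MemSobolev 2 ∞ W)
    (hμ : IsStationaryState σ V W μbar) (x : WeightedL2 μbar × WeightedL2 μbar)
    (hx : x ∈ linearizedGraph σ V W μbar hW hμ) (hx0 : x.1 = 0) : x.2 = 0 := by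
  have h0 := (linearizedGraph σ V W μbar hW hμ).zero_mem
  obtain ⟨y, f⟩ := x
  obtain rfl : y = 0 := hx0
  have h : (f : Torus d → ℂ) =ᵐ[volume] ((0 : WeightedL2 μbar) : Torus d → ℂ) :=
    hx.2.unique h0.2
  exact Lp.ext ((withDensity_absolutelyContinuous _ _).ae_eq h)

/-- The linearized McKean–Vlasov operator
`𝓛 y = ∇ · (y ∇V + σ ∇y) + ∇ · (y (∇W * μbar) + μbar (∇W * y))`
as an unbounded operator on `𝒳 = L²(𝕋^d, μbar⁻¹)` with domain `H²(𝕋^d)`. (For `V ∈ C²`,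
`W ∈ W^{2,∞}` and `y ∈ H²` the flux is in `H¹`, so its weak divergence exists in `L²`.) -/
noncomputable def linearizedOperator (σ : ℝ) (V W μbar : Torus d → ℝ) (hW : MemSobolev 2 ∞ W)
    (hμ : IsStationaryState σ V W μbar) : WeightedL2 μbar →ₗ.[ℂ] WeightedL2 μbar :=
  (linearizedGraph σ V W μbar hW hμ).toLinearPMap

/-- The value of the operator is the weak divergence of the flux. -/
lemma linearizedOperator_graph (hW : MemSobolev 2 ∞ W) (hμ : IsStationaryState σ V W μbar) :
    (linearizedOperator σ V W μbar hW hμ).graph = linearizedGraph σ V W μbar hW hμ :=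
  Submodule.toLinearPMap_graph_eq _ (linearizedGraph_snd_eq_zero hW hμ)

end Aux

/-- The resolvent set of an unbounded operator `T`: those `z` for which `z - T : D(T) → X` has a
bounded two-sided inverse `R` defined on all of `X`. -/
def opResolventSet {X : Type*} [NormedAddCommGroup X] [NormedSpace ℂ X] (T : X →ₗ.[ℂ] X) : Set ℂ :=
  {z | ∃ R : X →L[ℂ] X,
    (∀ f : X, ∃ h : R f ∈ T.domain, z • R f - T ⟨R f, h⟩ = f) ∧
    ∀ y : T.domain, R (z • (y : X) - T y) = y}

/-- The spectrum of an unbounded operator. -/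
def opSpectrum {X : Type*} [NormedAddCommGroup X] [NormedSpace ℂ X] (T : X →ₗ.[ℂ] X) : Set ℂ :=
  (opResolventSet T)ᶜ

end McKeanVlasov

/-! The linearized operator `𝓛` is a lower-order perturbation of `σΔ`. Expanding the divergence
gives `𝓛 y = σΔy + ∑ i, gᵢ ∂ᵢy + B₀ y`, where `g = ∇v[μbar]` is bounded and `B₀` is a bounded
operator on `L²`. The nonlocal terms go into `B₀`: derivatives of `W * y` fall on `W`, whose
derivatives up to order two are bounded, so `∂ᵢμbar` need only be square integrable.

Let `R = (z - σΔ)⁻¹`, the Fourier multiplier with symbol `1 / (z + σ|k|²)`. Then `(z - 𝓛) R = 1 - T`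
with `T = ∑ i, gᵢ ∂ᵢR + B₀ R`. On the half-plane `Re z ≥ -δ` the norms of `R` and `∂ᵢR` become
arbitrarily small as `|z|` grows (`exists_symbol_bound`). Hence `‖T‖ < 1` for large `|z|`, the
Neumann series inverts `1 - T`, and `R (1 - T)⁻¹` is a two-sided inverse of `z - 𝓛`. It is compact
because `R` is (`IsLaplaceResolvent.exists_resolvent`).

So the spectrum in the half-plane lies in a ball. A compact resolvent at one point turns spectral
points in that ball into eigenvalues of a compact operator bounded away from zero, and Riesz's
theorem leaves only finitely many (`finite_opSpectrum_inter_of_isCompactOperator`).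

The Fourier analysis takes place in unweighted `L²`. Passing to the weight `μbar⁻¹` is harmless
because a stationary state is a Gibbs density `c exp(-v[μbar]/σ)`, which is bounded above and away
from zero (`IsStationaryState.exists_bounds`). Weak derivatives in `L²` are handled through Fourier
coefficients, where `∂ᵢ` is multiplication by `i kᵢ`. -/

namespace McKeanVlasov

/-! ### Classical partial derivatives and integration by parts on the torus -/

section Calculus

variable {d : ℕ}

instance instIsAddHaarMeasureTorus : (volume : Measure (Torus d)).IsAddHaarMeasure := by
  rw [volume_pi]; infer_instance

lemma cover_surjective : Function.Surjective (cover : (Fin d → ℝ) → Torus d) :=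
  isOpenQuotientMap_cover.surjective

lemma cover_add_smul_single (x : Fin d → ℝ) (i : Fin d) (s : ℝ) :
    cover (x + s • Pi.single i 1) = cover x + Pi.single i (s : AddCircle (2 * Real.pi)) := by
  funext j
  by_cases hj : j = i
  · subst hj; simp [cover]
  · simp [cover, hj]

lemma IsCn.hasDerivAt {n : WithTop ℕ∞} (hn : 1 ≤ n) {f : Torus d → ℝ} (h : IsCn n f)
    (i : Fin d) (t : Torus d) (s : ℝ) :
    HasDerivAt (fun s : ℝ => f (t + Pi.single i (s : AddCircle (2 * Real.pi))))
      (torusPartial i f (t + Pi.single i (s : AddCircle (2 * Real.pi)))) s := by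
  obtain ⟨x, rfl⟩ := cover_surjective t
  simp_rw [← cover_add_smul_single]
  rw [torusPartial_cover hn h]
  have hd : DifferentiableAt ℝ (fun x : Fin d → ℝ => f (cover x)) (x + s • Pi.single i 1) :=
    (ContDiff.differentiable h (by positivity)) _
  have h2 : HasDerivAt (fun s : ℝ => x + s • (Pi.single i 1 : Fin d → ℝ)) (Pi.single i 1) s := by
    simpa using ((hasDerivAt_id s).smul_const (Pi.single i 1 : Fin d → ℝ)).const_add x
  exact hd.hasFDerivAt.comp_hasDerivAt s h2

lemma torusPartial_eq_of_hasDerivAt {f : Torus d → ℝ} {i : Fin d} {t : Torus d} {a : ℝ}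
    (h : HasDerivAt (fun s : ℝ => f (t + Pi.single i (s : AddCircle (2 * Real.pi)))) a 0) :
    torusPartial i f t = a := h.deriv

lemma IsCn.hasDerivAt_zero {n : WithTop ℕ∞} (hn : 1 ≤ n) {f : Torus d → ℝ} (h : IsCn n f)
    (i : Fin d) (t : Torus d) :
    HasDerivAt (fun s : ℝ => f (t + Pi.single i (s : AddCircle (2 * Real.pi))))
      (torusPartial i f t) 0 := by
  simpa using h.hasDerivAt hn i t 0

lemma torusPartial_mul {n : WithTop ℕ∞} (hn : 1 ≤ n) {f g : Torus d → ℝ} (hf : IsCn n f)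
    (hg : IsCn n g) (i : Fin d) (t : Torus d) :
    torusPartial i (fun x => f x * g x) t = torusPartial i f t * g t + f t * torusPartial i g t := by
  apply torusPartial_eq_of_hasDerivAt
  have h := (hf.hasDerivAt_zero hn i t).fun_mul (hg.hasDerivAt_zero hn i t)
  simpa only [QuotientAddGroup.mk_zero, AddCircle.coe_zero, Pi.single_zero, add_zero] using h

lemma IsCn.mul {n : WithTop ℕ∞} {f g : Torus d → ℝ} (hf : IsCn n f) (hg : IsCn n g) :
    IsCn n (fun x => f x * g x) := by
  have hf : ContDiff ℝ n fun x => f (cover x) := hf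
  exact hf.mul hg

lemma IsCn.of_le {m n : WithTop ℕ∞} (hmn : m ≤ n) {f : Torus d → ℝ} (hf : IsCn n f) : IsCn m f :=
  ContDiff.of_le hf hmn

lemma IsCn.torusPartial {f : Torus d → ℝ} (h : IsCn 2 f) (i : Fin d) :
    IsCn 1 (torusPartial i f) := by
  have e : (fun x : Fin d → ℝ => McKeanVlasov.torusPartial i f (cover x)) =
      fun x => fderiv ℝ (fun x : Fin d → ℝ => f (cover x)) x (Pi.single i 1) := by
    funext x
    exact torusPartial_cover (by norm_num) h i x
  rw [IsCn, e]
  exact (ContDiff.fderiv_right h (by norm_num)).clm_apply contDiff_const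

lemma exists_bound_of_continuous {f : Torus d → ℝ} (hf : Continuous f) :
    ∃ C, ∀ x, ‖f x‖ ≤ C := by
  obtain ⟨C, hC⟩ := isCompact_univ.exists_bound_of_continuousOn (f := f) hf.continuousOn
  exact ⟨C, fun x => hC x (Set.mem_univ x)⟩

lemma integrable_of_continuous {f : Torus d → ℝ} (hf : Continuous f) : Integrable f := by
  obtain ⟨C, hC⟩ := exists_bound_of_continuous hf
  exact Integrable.of_bound hf.aestronglyMeasurable C (Eventually.of_forall hC)

/-- Partial derivatives of `C¹` functions have mean zero. -/
lemma integral_torusPartial {f : Torus d → ℝ} (hf : IsCn 1 f) (i : Fin d) :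
    ∫ x, torusPartial i f x = 0 := by
  have hc := hf.continuous_torusPartial le_rfl i
  obtain ⟨C, hC⟩ := exists_bound_of_continuous hc
  have hcont (g : Torus d → ℝ) (hg : Continuous g) (s : ℝ) : Continuous fun x : Torus d =>
      g (x + (Pi.single i (s : AddCircle (2 * Real.pi)) : Torus d)) :=
    hg.comp (continuous_id.add continuous_const)
  have hm : ∀ᶠ s : ℝ in nhds 0, AEStronglyMeasurable (fun x : Torus d =>
      f (x + (Pi.single i (s : AddCircle (2 * Real.pi)) : Torus d))) volume :=
    Eventually.of_forall fun s => (hcont f hf.continuous s).aestronglyMeasurable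
  have h1 : ∀ᵐ x : Torus d, ∀ s ∈ (Set.univ : Set ℝ), ‖torusPartial i f
      (x + Pi.single i (s : AddCircle (2 * Real.pi)))‖ ≤ C :=
    Eventually.of_forall fun x s _ => hC _
  have h3 : ∀ᵐ x : Torus d, ∀ s ∈ (Set.univ : Set ℝ),
      HasDerivAt (fun s : ℝ => f (x + Pi.single i (s : AddCircle (2 * Real.pi))))
        (torusPartial i f (x + Pi.single i (s : AddCircle (2 * Real.pi)))) s :=
    Eventually.of_forall fun x s _ => hf.hasDerivAt le_rfl i x s
  -- By translation invariance this integral does not depend on `s`, while differentiating under the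
  -- integral sign yields the integral of the partial derivative.
  have h2 : HasDerivAt
      (fun s : ℝ => ∫ x, f (x + (Pi.single i (s : AddCircle (2 * Real.pi)) : Torus d)))
      (∫ x, torusPartial i f (x + (Pi.single i ((0 : ℝ) : AddCircle (2 * Real.pi)) : Torus d))) 0 :=
    (hasDerivAt_integral_of_dominated_loc_of_deriv_le univ_mem hm
      (integrable_of_continuous (hcont f hf.continuous 0))
      (hcont _ hc 0).aestronglyMeasurable h1 (integrable_const C) h3).2
  have e1 : (fun s : ℝ => ∫ x, f (x + (Pi.single i (s : AddCircle (2 * Real.pi)) : Torus d)))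
      = fun _ => ∫ x, f x := by
    funext s
    exact integral_add_right_eq_self f _
  have e2 : ∫ x, torusPartial i f (x + (Pi.single i ((0 : ℝ) : AddCircle (2 * Real.pi)) : Torus d))
      = ∫ x, torusPartial i f x := integral_add_right_eq_self _ _
  rw [e1, e2] at h2
  exact h2.unique (hasDerivAt_const (0 : ℝ) (∫ x, f x))

/-- A `C¹` function has its classical partial derivative as weak partial derivative. -/
lemma IsCn.hasWeakPartial {f : Torus d → ℝ} (hf : IsCn 1 f) (i : Fin d) :
    HasWeakPartial i f (McKeanVlasov.torusPartial i f) := by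
  have hc := hf.continuous_torusPartial le_rfl i
  refine ⟨integrable_of_continuous hf.continuous, integrable_of_continuous hc, fun φ hφ => ?_⟩
  have hφ1 : IsCn 1 φ := hφ.of_le (by norm_num)
  have hφc := hφ1.continuous_torusPartial le_rfl i
  have h := integral_torusPartial (hφ1.mul hf) i
  simp_rw [torusPartial_mul le_rfl hφ1 hf] at h
  have i1 := integrable_of_continuous (hφc.fun_mul hf.continuous)
  have i2 := integrable_of_continuous (hφ1.continuous.fun_mul hc)
  rw [integral_add i1 i2] at h
  simp_rw [smul_eq_mul]
  linarith

end Calculus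

/-! ### Exponentials as test functions -/

section Modes

variable {d : ℕ}

/-- The exponential `x ↦ exp (i k · x)` on the torus. -/
noncomputable def mode (k : Fin d → ℤ) : C(Torus d, ℂ) where
  toFun x := ∏ i : Fin d, fourier (k i) (x i)
  continuous_toFun := by fun_prop

lemma mode_apply (k : Fin d → ℤ) (x : Torus d) : mode k x = ∏ i, fourier (k i) (x i) := rfl

lemma mode_neg (k : Fin d → ℤ) (x : Torus d) : mode (-k) x = (starRingEnd ℂ) (mode k x) := by
  simp only [mode, Pi.neg_apply, fourier_neg, ContinuousMap.coe_mk, map_prod]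

lemma mode_add (k l : Fin d → ℤ) (x : Torus d) : mode (k + l) x = mode k x * mode l x := by
  simp only [mode, Pi.add_apply, fourier_add, ContinuousMap.coe_mk, ← Finset.prod_mul_distrib]

lemma mode_zero (x : Torus d) : mode (0 : Fin d → ℤ) x = 1 := by
  simp only [mode, Pi.zero_apply, fourier_zero, Finset.prod_const_one, ContinuousMap.coe_mk]

lemma norm_mode (k : Fin d → ℤ) (x : Torus d) : ‖mode k x‖ = 1 := by
  simp only [mode, fourier_apply, ContinuousMap.coe_mk, norm_prod, Circle.norm_coe,
      Finset.prod_const_one]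

lemma mode_single (x : Torus d) (i : Fin d) : mode (Pi.single i 1) x = fourier 1 (x i) := by
  rw [mode_apply, Finset.prod_eq_single i]
  · simp
  · intro j _ hj
    rw [Pi.single_eq_of_ne hj, fourier_zero]
  · simp

lemma mode_cover (k : Fin d → ℤ) (x : Fin d → ℝ) :
    mode k (cover x) = Complex.exp (Complex.I * ∑ i, (k i : ℂ) * x i) := by
  rw [mode_apply, Finset.mul_sum, Complex.exp_sum]
  refine Finset.prod_congr rfl fun i _ => ?_
  rw [cover, fourier_coe_apply]
  congr 1
  have : (Real.pi : ℂ) ≠ 0 := by exact_mod_cast Real.pi_ne_zero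
  push_cast
  field_simp

lemma contDiff_mode_cover (k : Fin d → ℤ) :
    ContDiff ℝ ∞ fun x : Fin d → ℝ => mode k (cover x) := by
  simp_rw [mode_cover]
  apply ContDiff.cexp
  apply ContDiff.mul contDiff_const
  apply ContDiff.sum
  intro i _
  apply ContDiff.mul contDiff_const
  exact Complex.ofRealCLM.contDiff.comp (contDiff_apply ℝ ℝ i)

lemma isCn_mode_re (k : Fin d → ℤ) : IsCn ∞ fun x => (mode k x).re :=
  Complex.reCLM.contDiff.comp (contDiff_mode_cover k)

lemma isCn_mode_im (k : Fin d → ℤ) : IsCn ∞ fun x => (mode k x).im :=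
  Complex.imCLM.contDiff.comp (contDiff_mode_cover k)

lemma mode_hasDerivAt (k : Fin d → ℤ) (i : Fin d) (t : Torus d) :
    HasDerivAt (fun s : ℝ => mode k (t + Pi.single i (s : AddCircle (2 * Real.pi))))
      (Complex.I * k i * mode k t) 0 := by
  obtain ⟨x, rfl⟩ := cover_surjective t
  simp_rw [← cover_add_smul_single, mode_cover]
  have e (s : ℝ) : (∑ j, (k j : ℂ) * ((x + s • Pi.single i (1 : ℝ) : Fin d → ℝ) j : ℝ))
      = (∑ j, (k j : ℂ) * x j) + k i * (s : ℂ) := by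
    simp only [Pi.add_apply, Pi.smul_apply, smul_eq_mul, Complex.ofReal_add, mul_add,
      Finset.sum_add_distrib, add_right_inj]
    rw [Finset.sum_eq_single i]
    · simp
    · intro j _ hj
      simp [Pi.single_eq_of_ne hj]
    · simp
  simp_rw [e]
  have h1 : HasDerivAt (fun s : ℝ => Complex.I * ((∑ j, (k j : ℂ) * x j) + k i * (s : ℂ)))
      (Complex.I * (k i * 1)) 0 :=
    (((Complex.ofRealCLM.hasDerivAt (x := (0 : ℝ))).const_mul (k i : ℂ)).const_add _).const_mul _
  convert! h1.cexp using 1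
  simp
  ring

lemma torusPartial_mode_re (k : Fin d → ℤ) (i : Fin d) (t : Torus d) :
    torusPartial i (fun x => (mode k x).re) t = (Complex.I * k i * mode k t).re :=
  torusPartial_eq_of_hasDerivAt
    (Complex.reCLM.hasFDerivAt.comp_hasDerivAt (0 : ℝ) (mode_hasDerivAt k i t))

lemma torusPartial_mode_im (k : Fin d → ℤ) (i : Fin d) (t : Torus d) :
    torusPartial i (fun x => (mode k x).im) t = (Complex.I * k i * mode k t).im :=
  torusPartial_eq_of_hasDerivAt
    (Complex.imCLM.hasFDerivAt.comp_hasDerivAt (0 : ℝ) (mode_hasDerivAt k i t))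

lemma integrable_mode_mul (k : Fin d → ℤ) {f : Torus d → ℂ} (hf : Integrable f) :
    Integrable fun x => mode k x * f x :=
  hf.bdd_mul (c := 1) (mode k).continuous.aestronglyMeasurable
    (Eventually.of_forall fun x => (norm_mode k x).le)

/-- Testing a weak derivative against `φ e_k` with `φ` smooth. -/
lemma HasWeakPartial.integral_mode_mul {i : Fin d} {f g : Torus d → ℂ} (h : HasWeakPartial i f g)
    {φ : Torus d → ℝ} (hφ : IsCn ∞ φ) (k : Fin d → ℤ) :
    ∫ x, mode k x * (φ x * g x)
      = - ∫ x, mode k x * ((torusPartial i φ x + Complex.I * k i * φ x) * f x) := by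
  have hφ1 : IsCn 1 φ := hφ.of_le (by norm_num)
  have hre1 := (isCn_mode_re k).of_le (m := 1) (by norm_num)
  have him1 := (isCn_mode_im k).of_le (m := 1) (by norm_num)
  -- Test functions are real-valued, so the real and imaginary parts of `φ e_k` are tested
  -- separately and recombined.
  have hre := h.2.2 _ (hφ.mul (isCn_mode_re k))
  have him := h.2.2 _ (hφ.mul (isCn_mode_im k))
  simp_rw [torusPartial_mul le_rfl hφ1 hre1, torusPartial_mode_re] at hre
  simp_rw [torusPartial_mul le_rfl hφ1 him1, torusPartial_mode_im] at him
  have hcp := hφ1.continuous_torusPartial le_rfl i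
  have hc := hφ.continuous
  have hm := (mode k).continuous
  have ig {a : Torus d → ℝ} (ha : Continuous a) : Integrable fun x => a x • g x :=
    integrable_smul_of_continuous ha h.2.1
  have iff' {a : Torus d → ℝ} (ha : Continuous a) : Integrable fun x => a x • f x :=
    integrable_smul_of_continuous ha h.1
  have hcr : Continuous fun x => (mode k x).re := Complex.continuous_re.comp hm
  have hci : Continuous fun x => (mode k x).im := Complex.continuous_im.comp hm
  have hdr : Continuous fun x => (Complex.I * k i * mode k x).re :=
    Complex.continuous_re.comp (hm.const_mul _)
  have hdi : Continuous fun x => (Complex.I * k i * mode k x).im :=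
    Complex.continuous_im.comp (hm.const_mul _)
  have e1 : ∫ x, mode k x * (φ x * g x) = (∫ x, (φ x * (mode k x).re) • g x)
      + Complex.I * ∫ x, (φ x * (mode k x).im) • g x := by
    rw [← integral_const_mul, ← integral_add (ig (hc.fun_mul hcr)) ((ig (hc.fun_mul hci)).const_mul _)]
    congr 1; funext x
    conv_lhs => rw [← Complex.re_add_im (mode k x)]
    simp only [Complex.real_smul, Complex.ofReal_mul]
    ring
  have e2 : ∫ x, mode k x * ((torusPartial i φ x + Complex.I * k i * φ x) * f x)
      = (∫ x, (torusPartial i φ x * (mode k x).re + φ x * (Complex.I * k i * mode k x).re) • f x)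
      + Complex.I * ∫ x, (torusPartial i φ x * (mode k x).im
        + φ x * (Complex.I * k i * mode k x).im) • f x := by
    rw [← integral_const_mul, ← integral_add (iff' ((hcp.fun_mul hcr).fun_add (hc.fun_mul hdr)))
      ((iff' ((hcp.fun_mul hci).fun_add (hc.fun_mul hdi))).const_mul _)]
    congr 1; funext x
    have h1 := Complex.re_add_im (mode k x)
    have h2 := Complex.re_add_im (Complex.I * k i * mode k x)
    simp only [Complex.real_smul, Complex.ofReal_mul, Complex.ofReal_add]
    linear_combination (-(torusPartial i φ x : ℂ) * f x) * h1 - (φ x : ℂ) * f x * h2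
  rw [e1, e2, hre, him]
  ring

lemma isCn_const (c : ℝ) : IsCn ∞ (fun _ : Torus d => c) := contDiff_const

lemma torusPartial_const (i : Fin d) (c : ℝ) (t : Torus d) :
    torusPartial i (fun _ => c) t = 0 := by
  simp [torusPartial]

lemma HasWeakPartial.integral_mode {i : Fin d} {f g : Torus d → ℂ} (h : HasWeakPartial i f g)
    (k : Fin d → ℤ) :
    ∫ x, mode k x * g x = - (Complex.I * k i * ∫ x, mode k x * f x) := by
  have := h.integral_mode_mul (isCn_const 1) k
  simp_rw [torusPartial_const] at this
  simp only [Complex.ofReal_one, one_mul, Complex.ofReal_zero, zero_add, mul_one] at this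
  rw [this, ← integral_const_mul]
  congr 2; funext x; ring

end Modes

/-! ### The Fourier basis of `L²` -/

section Basis

variable {d : ℕ}

/-- The constant `1` has weak derivative zero; testing it against `e_k` in a direction with `k i ≠
0` gives `i kᵢ ∫ e_k = 0`. -/
lemma integral_mode_of_ne {k : Fin d → ℤ} (hk : k ≠ 0) : ∫ x, mode k x = 0 := by
  obtain ⟨i, hi⟩ := Function.ne_iff.1 hk
  have h : HasWeakPartial i (fun _ : Torus d => (1 : ℂ)) 0 := by
    refine ⟨integrable_const _, integrable_zero _ _ _, fun φ hφ => ?_⟩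
    have h := integral_torusPartial (hφ.of_le (m := 1) (by norm_num)) i
    have h2 : ∫ x, torusPartial i φ x • (1 : ℂ) = ((∫ x, torusPartial i φ x : ℝ) : ℂ) := by
      rw [← integral_complex_ofReal]
      congr 1; funext x; simp
    rw [h2, h]
    simp
  have := h.integral_mode k
  simp only [Pi.zero_apply, mul_zero, integral_zero, mul_one] at this
  have h3 : Complex.I * (k i : ℂ) ≠ 0 := mul_ne_zero Complex.I_ne_zero (by exact_mod_cast hi)
  have h4 : Complex.I * (k i : ℂ) * ∫ x, mode k x = 0 := by
    linear_combination this
  exact (mul_eq_zero.1 h4).resolve_left h3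

/-- The star subalgebra of `C(𝕋^d, ℂ)` generated by the exponentials. -/
noncomputable def modeSubalgebra (d : ℕ) : StarSubalgebra ℂ C(Torus d, ℂ) where
  toSubalgebra := Algebra.adjoin ℂ (Set.range mode)
  star_mem' := by
    change Algebra.adjoin ℂ (Set.range mode) ≤ star (Algebra.adjoin ℂ (Set.range mode))
    refine Algebra.adjoin_le ?_
    rintro _ ⟨n, rfl⟩
    refine Algebra.subset_adjoin ⟨-n, ?_⟩
    ext1 x
    simp only [mode_neg, starRingEnd_apply, ContinuousMap.star_apply]

/-- Products of exponentials are exponentials, so the generated algebra is already the linear span.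
This turns Stone–Weierstrass into density of trigonometric polynomials. -/
lemma modeSubalgebra_coe :
    (modeSubalgebra d).toSubalgebra.toSubmodule = Submodule.span ℂ (Set.range mode) := by
  apply Algebra.adjoin_eq_span_of_subset
  refine .trans (fun x => Submonoid.closure_induction (fun _ => id) ⟨0, ?_⟩ ?_)
    Submodule.subset_span
  · ext z
    rw [mode_zero, ContinuousMap.one_apply]
  · rintro _ _ _ _ ⟨m, rfl⟩ ⟨n, rfl⟩
    refine ⟨m + n, ?_⟩
    ext z
    rw [mode_add, ContinuousMap.mul_apply]

lemma modeSubalgebra_separatesPoints : (modeSubalgebra d).SeparatesPoints := by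
  intro x y hxy
  obtain ⟨i, hi⟩ := Function.ne_iff.1 hxy
  refine ⟨_, ⟨mode (Pi.single i 1), Algebra.subset_adjoin ⟨Pi.single i 1, rfl⟩, rfl⟩, ?_⟩
  change mode _ x ≠ mode _ y
  rw [mode_single, mode_single, fourier_one, fourier_one]
  exact fun h => hi (AddCircle.injective_toCircle Real.two_pi_pos.ne' (Circle.coe_injective h))

lemma span_mode_closure_eq_top :
    (Submodule.span ℂ (Set.range (mode (d := d)))).topologicalClosure = ⊤ := by
  rw [← modeSubalgebra_coe]
  exact congr_arg (Subalgebra.toSubmodule <| StarSubalgebra.toSubalgebra ·)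
    (ContinuousMap.starSubalgebra_topologicalClosure_eq_top_of_separatesPoints _
      (modeSubalgebra_separatesPoints (d := d)))

/-- The space `L²(𝕋^d)`. -/
abbrev TorusL2 (d : ℕ) : Type := Lp ℂ 2 (volume : Measure (Torus d))

/-- The exponential `e_k` as an element of `L²(𝕋^d)`. -/
noncomputable abbrev modeLp (k : Fin d → ℤ) : TorusL2 d :=
  ContinuousMap.toLp (E := ℂ) 2 volume ℂ (mode k)

lemma coeFn_modeLp (k : Fin d → ℤ) : modeLp k =ᵐ[volume] mode k :=
  ContinuousMap.coeFn_toLp volume (mode k)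

/-- The normalisation constant of the Fourier basis. -/
noncomputable def modeScale (d : ℕ) : ℝ := √((volume : Measure (Torus d)).real Set.univ)

lemma modeScale_sq : modeScale d ^ 2 = (volume : Measure (Torus d)).real Set.univ :=
  Real.sq_sqrt measureReal_nonneg

lemma modeScale_pos : 0 < modeScale d :=
  Real.sqrt_pos.2 (ENNReal.toReal_pos
    (IsOpen.measure_ne_zero _ isOpen_univ Set.univ_nonempty) (measure_ne_top _ _))

lemma inner_modeLp (k l : Fin d → ℤ) :
    inner ℂ (modeLp k) (modeLp l) = if k = l then ((modeScale d : ℂ) ^ 2) else 0 := by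
  rw [ContinuousMap.inner_toLp]
  simp_rw [← mode_neg, ← mode_add]
  split_ifs with h
  · subst h
    simp_rw [add_neg_cancel, mode_zero]
    rw [integral_const, ← Complex.ofReal_pow, modeScale_sq]
    simp
  · exact integral_mode_of_ne fun h' => h (by rwa [← sub_eq_add_neg, sub_eq_zero, eq_comm] at h')

lemma orthonormal_modeLp : Orthonormal ℂ fun k : Fin d → ℤ => ((modeScale d : ℂ)⁻¹) • modeLp k := by
  rw [orthonormal_iff_ite]
  intro k l
  rw [inner_smul_left, inner_smul_right, inner_modeLp]
  have : (modeScale d : ℂ) ≠ 0 := by exact_mod_cast modeScale_pos.ne'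
  split_ifs
  · simp only [map_inv₀, Complex.conj_ofReal]
    field_simp
  · simp

lemma span_modeLp_closure_eq_top :
    (Submodule.span ℂ (Set.range (modeLp (d := d)))).topologicalClosure = ⊤ := by
  simpa only [Submodule.map_span, ContinuousLinearMap.coe_coe, ← Set.range_comp,
    Function.comp_def] using
    (ContinuousMap.toLp_denseRange ℂ volume ℂ (by simp)).topologicalClosure_map_submodule
      (span_mode_closure_eq_top (d := d))

/-- The Fourier basis of `L²(𝕋^d)`. -/
noncomputable def modeBasis (d : ℕ) : HilbertBasis (Fin d → ℤ) ℂ (TorusL2 d) :=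
  HilbertBasis.mk orthonormal_modeLp (by
    rw [← span_modeLp_closure_eq_top]
    apply Submodule.topologicalClosure_mono
    rw [Submodule.span_le]
    rintro _ ⟨k, rfl⟩
    have : (modeScale d : ℂ) ≠ 0 := by exact_mod_cast modeScale_pos.ne'
    have e : modeLp k = (modeScale d : ℂ) • ((modeScale d : ℂ)⁻¹ • modeLp k) := by
      rw [smul_smul, mul_inv_cancel₀ this, one_smul]
    rw [e]
    exact Submodule.smul_mem _ _ (Submodule.subset_span ⟨k, rfl⟩))

lemma modeBasis_repr (f : TorusL2 d) (k : Fin d → ℤ) :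
    (modeBasis d).repr f k = (modeScale d : ℂ)⁻¹ * ∫ x, mode (-k) x * f x := by
  rw [HilbertBasis.repr_apply_apply, modeBasis, HilbertBasis.coe_mk, inner_smul_left,
    MeasureTheory.L2.inner_def]
  simp only [map_inv₀, Complex.conj_ofReal]
  congr 1
  refine integral_congr_ae ?_
  filter_upwards [coeFn_modeLp k] with x hx
  rw [hx, mode_neg, RCLike.inner_apply, mul_comm]

end Basis

/-! ### Weak derivatives through Fourier coefficients -/

section Fourier

variable {d : ℕ}

lemma modeBasis_repr_toLp {f : Torus d → ℂ} (hf : MemLp f 2 volume) (k : Fin d → ℤ) :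
    (modeBasis d).repr (hf.toLp f) k = (modeScale d : ℂ)⁻¹ * ∫ x, mode (-k) x * f x := by
  rw [modeBasis_repr]
  congr 1
  refine integral_congr_ae ?_
  filter_upwards [hf.coeFn_toLp] with x hx
  rw [hx]

/-- Integration by parts, in terms of Fourier coefficients. -/
lemma inner_eq_neg_inner_of_repr {i : Fin d} {A B f g : TorusL2 d}
    (hfg : ∀ k, (modeBasis d).repr g k = Complex.I * k i * (modeBasis d).repr f k)
    (hAB : ∀ k, (modeBasis d).repr B k = Complex.I * k i * (modeBasis d).repr A k) :
    inner ℂ A g = - inner ℂ B f := by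
  -- Parseval on both sides; the sign appears because `i kᵢ` is purely imaginary and one factor is
  -- conjugated.
  rw [← (modeBasis d).tsum_inner_mul_inner A g, ← (modeBasis d).tsum_inner_mul_inner B f,
    ← tsum_neg]
  congr 1
  funext k
  rw [← HilbertBasis.repr_apply_apply, ← HilbertBasis.repr_apply_apply, hfg k,
    ← inner_conj_symm A, ← inner_conj_symm B, ← HilbertBasis.repr_apply_apply,
    ← HilbertBasis.repr_apply_apply, hAB k]
  simp only [map_mul, Complex.conj_I, map_intCast]
  ring

lemma HasWeakPartial.congr_right {E : Type*} [NormedAddCommGroup E] [NormedSpace ℝ E] {i : Fin d}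
    {f g g' : Torus d → E} (h : HasWeakPartial i f g) (hg : g =ᵐ[volume] g') :
    HasWeakPartial i f g' := by
  refine ⟨h.1, h.2.1.congr hg, fun φ hφ => ?_⟩
  rw [← h.2.2 φ hφ]
  refine integral_congr_ae ?_
  filter_upwards [hg] with x hx
  rw [hx]

lemma HasWeakPartial.repr {i : Fin d} {f g : TorusL2 d} (h : HasWeakPartial i (f : Torus d → ℂ) g)
    (k : Fin d → ℤ) :
    (modeBasis d).repr g k = Complex.I * k i * (modeBasis d).repr f k := by
  rw [modeBasis_repr, modeBasis_repr, h.integral_mode]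
  simp only [Pi.neg_apply, Int.cast_neg]
  ring

lemma integral_smul_ofReal (φ f : Torus d → ℝ) :
    ∫ x, φ x • (f x : ℂ) = ((∫ x, φ x • f x : ℝ) : ℂ) := by
  rw [← integral_complex_ofReal]
  congr 1; funext x; simp

lemma hasWeakPartial_ofReal {i : Fin d} {f g : Torus d → ℝ} :
    HasWeakPartial i (fun x => (f x : ℂ)) (fun x => (g x : ℂ)) ↔ HasWeakPartial i f g := by
  constructor
  · intro h
    refine ⟨by simpa using h.1.re, by simpa using h.2.1.re, fun φ hφ => ?_⟩
    have := h.2.2 φ hφ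
    rw [integral_smul_ofReal, integral_smul_ofReal] at this
    exact_mod_cast this
  · intro h
    refine ⟨h.1.ofReal, h.2.1.ofReal, fun φ hφ => ?_⟩
    rw [integral_smul_ofReal, integral_smul_ofReal, h.2.2 φ hφ]
    push_cast
    rfl

lemma memLp_of_continuous {φ : Torus d → ℝ} (hφ : Continuous φ) (p : ℝ≥0∞) : MemLp φ p volume := by
  obtain ⟨C, hC⟩ := exists_bound_of_continuous hφ
  exact MemLp.of_bound hφ.aestronglyMeasurable C (Eventually.of_forall hC)

lemma integrable_of_memLp_two {E : Type*} [NormedAddCommGroup E] {f : Torus d → E}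
    (hf : MemLp f 2 volume) : Integrable f := hf.integrable (by norm_num)

/-- Weak derivatives in `L²` are characterised by Fourier coefficients. -/
lemma hasWeakPartial_of_repr {i : Fin d} {f g : TorusL2 d}
    (h : ∀ k, (modeBasis d).repr g k = Complex.I * k i * (modeBasis d).repr f k) :
    HasWeakPartial i (f : Torus d → ℂ) g := by
  refine ⟨integrable_of_memLp_two (Lp.memLp f), integrable_of_memLp_two (Lp.memLp g),
    fun φ hφ => ?_⟩
  have hφ1 : IsCn 1 φ := hφ.of_le (by norm_num)
  have hA : MemLp (fun x => (φ x : ℂ)) 2 volume := (memLp_of_continuous hφ.continuous 2).ofReal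
  have hB : MemLp (fun x => (torusPartial i φ x : ℂ)) 2 volume :=
    (memLp_of_continuous (hφ1.continuous_torusPartial le_rfl i) 2).ofReal
  have hAB : HasWeakPartial i (hA.toLp _ : Torus d → ℂ) (hB.toLp _) :=
    ((hasWeakPartial_ofReal.2 (hφ1.hasWeakPartial i)).congr hA.coeFn_toLp.symm).congr_right
      hB.coeFn_toLp.symm
  have key := inner_eq_neg_inner_of_repr h hAB.repr
  rw [MeasureTheory.L2.inner_def, MeasureTheory.L2.inner_def] at key
  -- As `φ` is real, conjugation in the inner product has no effect and the pairing is the one in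
  -- the definition of a weak derivative.
  have k1 : ∫ x, inner ℂ ((hA.toLp _ : TorusL2 d) x) (g x) = ∫ x, φ x • g x := by
    refine integral_congr_ae ?_
    filter_upwards [hA.coeFn_toLp] with x hx
    rw [hx]
    simp [mul_comm]
  have k2 : ∫ x, inner ℂ ((hB.toLp _ : TorusL2 d) x) (f x) = ∫ x, torusPartial i φ x • f x := by
    refine integral_congr_ae ?_
    filter_upwards [hB.coeFn_toLp] with x hx
    rw [hx]
    simp [mul_comm]
  rwa [k1, k2] at key

/-- The product rule for weak derivatives in `L²`. -/
lemma HasWeakPartial.mul_complex {i : Fin d} {f f' g g' : Torus d → ℂ} (hf : MemLp f 2 volume)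
    (hf' : MemLp f' 2 volume) (hg : MemLp g 2 volume) (hg' : MemLp g' 2 volume)
    (h : HasWeakPartial i f f') (h' : HasWeakPartial i g g') :
    HasWeakPartial i (fun x => f x * g x) (fun x => f' x * g x + f x * g' x) := by
  have int1 {a b : Torus d → ℂ} (ha : MemLp a 2 volume) (hb : MemLp b 2 volume) :
      Integrable fun x => a x * b x := ha.integrable_mul hb
  refine ⟨int1 hf hg, (int1 hf' hg).add (int1 hf hg'), fun φ hφ => ?_⟩
  have hφ1 : IsCn 1 φ := hφ.of_le (by norm_num)
  have hdc := hφ1.continuous_torusPartial le_rfl i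
  have hφi : MemLp (fun x => (φ x : ℂ)) ∞ volume := (memLp_of_continuous hφ.continuous ∞).ofReal
  have hdi : MemLp (fun x => (torusPartial i φ x : ℂ)) ∞ volume :=
    (memLp_of_continuous hdc ∞).ofReal
  have hA0 : MemLp (fun x => φ x * f x) 2 volume := hf.mul' hφi
  have hB0 : MemLp (fun x => φ x * f' x + torusPartial i φ x * f x) 2 volume :=
    MemLp.add (hf'.mul' hφi) (hf.mul' hdi)
  -- The product `φ f` is treated as a test function for `g`. Conjugating it turns the inner product
  -- into `∫ φ f g'`, and its Fourier coefficients are those obtained by testing `f` against `φ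
  -- e_k`.
  have hA : MemLp (fun x => (starRingEnd ℂ) (φ x * f x)) 2 volume := hA0.star
  have hB : MemLp (fun x => (starRingEnd ℂ) (φ x * f' x + torusPartial i φ x * f x)) 2 volume :=
    hB0.star
  have hAB (k : Fin d → ℤ) : (modeBasis d).repr (hB.toLp _) k
      = Complex.I * k i * (modeBasis d).repr (hA.toLp _) k := by
    rw [modeBasis_repr_toLp, modeBasis_repr_toLp]
    simp_rw [mode_neg, ← map_mul]
    rw [integral_conj, integral_conj]
    have e := h.integral_mode_mul hφ k
    have s1 : ∫ x, mode k x * (φ x * f' x + torusPartial i φ x * f x)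
        = (∫ x, mode k x * (φ x * f' x)) + ∫ x, mode k x * (torusPartial i φ x * f x) := by
      simp_rw [mul_add]
      exact integral_add
        (integrable_mode_mul k (integrable_of_memLp_two (hf'.mul' hφi)))
        (integrable_mode_mul k (integrable_of_memLp_two (hf.mul' hdi)))
    have s2 : ∫ x, mode k x * ((torusPartial i φ x + Complex.I * k i * φ x) * f x)
        = (∫ x, mode k x * (torusPartial i φ x * f x))
          + Complex.I * k i * ∫ x, mode k x * (φ x * f x) := by
      rw [← integral_const_mul, ← integral_add
        (integrable_mode_mul k (integrable_of_memLp_two (hf.mul' hdi)))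
        ((integrable_mode_mul k (integrable_of_memLp_two hA0)).const_mul _)]
      congr 1; funext x; ring
    rw [s1, e, s2]
    simp only [map_add, map_neg, map_mul, Complex.conj_I, map_intCast]
    ring
  have hgw : HasWeakPartial i (hg.toLp _ : Torus d → ℂ) (hg'.toLp _) :=
    (h'.congr hg.coeFn_toLp.symm).congr_right hg'.coeFn_toLp.symm
  have key := inner_eq_neg_inner_of_repr hgw.repr hAB
  rw [MeasureTheory.L2.inner_def, MeasureTheory.L2.inner_def] at key
  have k1 : ∫ x, inner ℂ ((hA.toLp _ : TorusL2 d) x) ((hg'.toLp _ : TorusL2 d) x)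
      = ∫ x, (φ x * f x) * g' x := by
    refine integral_congr_ae ?_
    filter_upwards [hA.coeFn_toLp, hg'.coeFn_toLp] with x hx hx'
    rw [hx, hx', RCLike.inner_apply, Complex.conj_conj, mul_comm]
  have k2 : ∫ x, inner ℂ ((hB.toLp _ : TorusL2 d) x) ((hg.toLp _ : TorusL2 d) x)
      = ∫ x, (φ x * f' x + torusPartial i φ x * f x) * g x := by
    refine integral_congr_ae ?_
    filter_upwards [hB.coeFn_toLp, hg.coeFn_toLp] with x hx hx'
    rw [hx, hx', RCLike.inner_apply, Complex.conj_conj, mul_comm]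
  rw [k1, k2] at key
  have t1 : ∫ x, φ x • (f' x * g x + f x * g' x)
      = (∫ x, (φ x * f' x) * g x) + ∫ x, (φ x * f x) * g' x := by
    rw [← integral_add (int1 (hf'.mul' hφi) hg) (int1 hA0 hg')]
    congr 1; funext x; simp only [Complex.real_smul]; ring
  have t2 : ∫ x, (φ x * f' x + torusPartial i φ x * f x) * g x
      = (∫ x, (φ x * f' x) * g x) + ∫ x, torusPartial i φ x • (f x * g x) := by
    have hi : Integrable fun x => torusPartial i φ x • (f x * g x) :=
      integrable_smul_of_continuous hdc (int1 hf hg)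
    rw [← integral_add (int1 (hf'.mul' hφi) hg) hi]
    congr 1; funext x; simp only [Complex.real_smul]; ring
  rw [t1, key, t2]
  ring

lemma HasWeakPartial.mul_real {i : Fin d} {f f' g g' : Torus d → ℝ} (hf : MemLp f 2 volume)
    (hf' : MemLp f' 2 volume) (hg : MemLp g 2 volume) (hg' : MemLp g' 2 volume)
    (h : HasWeakPartial i f f') (h' : HasWeakPartial i g g') :
    HasWeakPartial i (fun x => f x * g x) (fun x => f' x * g x + f x * g' x) := by
  rw [← hasWeakPartial_ofReal]
  have := HasWeakPartial.mul_complex hf.ofReal hf'.ofReal hg.ofReal hg'.ofReal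
    (hasWeakPartial_ofReal.2 h) (hasWeakPartial_ofReal.2 h')
  push_cast
  exact this

/-- A function in `L²` whose weak gradient vanishes is constant. -/
lemma ae_const_of_hasWeakPartial_zero {f : TorusL2 d}
    (h : ∀ i, HasWeakPartial i (f : Torus d → ℂ) ((0 : TorusL2 d) : Torus d → ℂ)) :
    ∃ c : ℂ, (f : Torus d → ℂ) =ᵐ[volume] fun _ => c := by
  let b := modeBasis d
  -- All coefficients satisfy `i kᵢ f̂(k) = 0` for every `i`, so only `k = 0` survives.
  have hz : ∀ k : Fin d → ℤ, k ≠ 0 → b.repr f k = 0 := by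
    intro k hk
    obtain ⟨i, hi⟩ := Function.ne_iff.1 hk
    have h1 := (h i).repr k
    rw [map_zero] at h1
    have h3 : Complex.I * (k i : ℂ) ≠ 0 := mul_ne_zero Complex.I_ne_zero (by exact_mod_cast hi)
    exact (mul_eq_zero.1 h1.symm).resolve_left h3
  have hs := b.hasSum_repr f
  have hs2 := hasSum_single (f := fun k => b.repr f k • b k) 0 fun k hk => by rw [hz k hk, zero_smul]
  have e : f = b.repr f 0 • b 0 := hs.unique hs2
  have e2 : b 0 = ((modeScale d : ℂ)⁻¹) • modeLp 0 := by
    simp only [b, modeBasis, HilbertBasis.coe_mk]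
  rw [e2, smul_smul] at e
  refine ⟨b.repr f 0 * (modeScale d : ℂ)⁻¹, ?_⟩
  have h4 := Lp.coeFn_smul (b.repr f 0 * (modeScale d : ℂ)⁻¹) (modeLp (d := d) 0)
  rw [← e] at h4
  filter_upwards [h4, coeFn_modeLp (0 : Fin d → ℤ)] with x hx hx'
  rw [hx, Pi.smul_apply, hx', mode_zero, smul_eq_mul, mul_one]

end Fourier

/-! ### Convolution with bounded kernels -/

section Conv

variable {d : ℕ}

instance instIsNegInvariantTorus : (volume : Measure (Torus d)).IsNegInvariant :=
  have : (volume : Measure (Torus d)).Regular := inferInstance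
  Measure.IsAddHaarMeasure.isNegInvariant_of_regular _

lemma integrable_of_memLp_top {E : Type*} [NormedAddCommGroup E] {K : Torus d → E}
    (hK : MemLp K ∞ volume) : Integrable K :=
  hK.integrable (by simp)

lemma memLp_two_of_memLp_top {E : Type*} [NormedAddCommGroup E] {K : Torus d → E}
    (hK : MemLp K ∞ volume) : MemLp K 2 volume :=
  hK.mono_exponent (by simp)

lemma exists_ae_bound {E : Type*} [NormedAddCommGroup E] {K : Torus d → E}
    (hK : MemLp K ∞ volume) : ∃ C : ℝ, 0 ≤ C ∧ ∀ᵐ x, ‖K x‖ ≤ C := by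
  refine ⟨(eLpNorm K (∞ : ℝ≥0∞) volume).toReal, ENNReal.toReal_nonneg, ?_⟩
  have h1 := ae_le_eLpNormEssSup (f := K) (μ := (volume : Measure (Torus d)))
  filter_upwards [h1] with x hx
  rw [eLpNorm_exponent_top]
  have h2 : eLpNormEssSup K volume ≠ (∞ : ℝ≥0∞) := by
    have := hK.2.ne
    rwa [eLpNorm_exponent_top] at this
  rw [← toReal_enorm]
  exact ENNReal.toReal_mono h2 hx

variable {E : Type*} [NormedAddCommGroup E] [NormedSpace ℝ E]

lemma torusPartial_translate (φ : Torus d → ℝ) (a : Torus d) (i : Fin d) (t : Torus d) :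
    torusPartial i (fun x => φ (x + a)) t = torusPartial i φ (t + a) := by
  simp only [torusPartial, add_right_comm]

lemma IsCn.translate {n : WithTop ℕ∞} {φ : Torus d → ℝ} (hφ : IsCn n φ) (a : Torus d) :
    IsCn n (fun x => φ (x + a)) := by
  obtain ⟨b, rfl⟩ := cover_surjective a
  have h : ContDiff ℝ n fun x : Fin d → ℝ => φ (cover (x + b)) :=
    ContDiff.comp (g := fun x : Fin d → ℝ => φ (cover x)) hφ (contDiff_id.add contDiff_const)
  have e (x : Fin d → ℝ) : cover (x + b) = cover x + cover b := by
    funext j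
    simp [cover]
  simp only [e] at h
  exact h

lemma norm_torusConv_le {K : Torus d → ℝ} {C : ℝ} (hC : ∀ᵐ x, ‖K x‖ ≤ C)
    {y : Torus d → E} (hy : Integrable y) (x : Torus d) :
    ‖torusConv K y x‖ ≤ C * ∫ t, ‖y t‖ := by
  rw [← integral_sub_left_eq_self (fun t => ‖y t‖) volume x, ← integral_const_mul]
  refine norm_integral_le_of_norm_le ((hy.norm.comp_sub_left x).const_mul C) ?_
  filter_upwards [hC] with t ht
  rw [ContinuousLinearMap.lsmul_apply, norm_smul]
  gcongr

lemma integrable_torusConv [CompleteSpace E] {K : Torus d → ℝ} (hK : MemLp K ∞ volume)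
    {y : Torus d → E} (hy : Integrable y) : Integrable (torusConv K y) :=
  (integrable_of_memLp_top hK).integrable_convolution (ContinuousLinearMap.lsmul ℝ ℝ) hy

lemma memLp_top_torusConv [CompleteSpace E] {K : Torus d → ℝ} (hK : MemLp K ∞ volume)
    {y : Torus d → E} (hy : Integrable y) : MemLp (torusConv K y) ∞ volume := by
  obtain ⟨C, -, hC⟩ := exists_ae_bound hK
  exact MemLp.of_bound (integrable_torusConv hK hy).aestronglyMeasurable _
    (Eventually.of_forall (norm_torusConv_le hC hy))

lemma torusConv_eq_swap (K : Torus d → ℝ) (y : Torus d → E) (x : Torus d) :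
    torusConv K y x = ∫ s, K (x - s) • y s := by
  rw [torusConv, convolution_eq_swap]
  rfl

/-- Fubini followed by the shift `x ↦ x + s` leaves the kernel in place and translates `φ` instead,
which keeps it an admissible test function for weak derivatives of `K`. -/
lemma integral_smul_torusConv [CompleteSpace E] {K : Torus d → ℝ} (hK : MemLp K ∞ volume)
    {y : Torus d → E} (hy : Integrable y) {φ : Torus d → ℝ} (hφ : Continuous φ) :
    ∫ x, φ x • torusConv K y x = ∫ s, (∫ x, φ (x + s) * K x) • y s := by
  have hi : Integrable (fun p : Torus d × Torus d => φ p.1 • (K (p.1 - p.2) • y p.2))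
      ((volume : Measure (Torus d)).prod volume) := by
    have h1 := hy.convolution_integrand (ContinuousLinearMap.lsmul ℝ ℝ).flip
      (integrable_of_memLp_top hK) (μ := (volume : Measure (Torus d)))
    obtain ⟨C, hC⟩ := exists_bound_of_continuous hφ
    exact h1.bdd_smul C (hφ.comp continuous_fst).aestronglyMeasurable
      (Eventually.of_forall fun p => hC p.1)
  simp_rw [torusConv_eq_swap, ← integral_smul]
  rw [integral_integral_swap hi]
  congr 1; funext s
  simp_rw [← mul_smul]
  rw [integral_smul_const]
  congr 1
  rw [← integral_add_right_eq_self (fun x => φ x * K (x - s)) s]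
  simp

/-- The derivative falls on the kernel, so `y` needs no regularity beyond integrability. -/
lemma HasWeakPartial.torusConv [CompleteSpace E] {i : Fin d} {K k : Torus d → ℝ}
    (hK : MemLp K ∞ volume) (hk : MemLp k ∞ volume) (h : HasWeakPartial i K k)
    {y : Torus d → E} (hy : Integrable y) :
    HasWeakPartial i (torusConv K y) (McKeanVlasov.torusConv k y) := by
  refine ⟨integrable_torusConv hK hy, integrable_torusConv hk hy, fun φ hφ => ?_⟩
  have hφ1 : IsCn 1 φ := hφ.of_le (by norm_num)
  rw [integral_smul_torusConv hk hy hφ.continuous,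
    integral_smul_torusConv hK hy (hφ1.continuous_torusPartial le_rfl i), ← integral_neg]
  congr 1; funext s
  have := h.2.2 _ (hφ.translate s)
  simp_rw [torusPartial_translate, smul_eq_mul] at this
  rw [this, neg_smul]

end Conv

/-! ### Chain rule for the exponential -/

section Exp

variable {d : ℕ}

/-- Dominated convergence on both sides of the defining identity: smooth test functions and their
derivatives are bounded. -/
lemma HasWeakPartial.of_tendsto {i : Fin d} {F G : ℕ → Torus d → ℝ} {f g bf bg : Torus d → ℝ}
    (h : ∀ n, HasWeakPartial i (F n) (G n)) (hbf : Integrable bf) (hbg : Integrable bg)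
    (hF : ∀ n, ∀ᵐ x, ‖F n x‖ ≤ bf x) (hG : ∀ n, ∀ᵐ x, ‖G n x‖ ≤ bg x)
    (hf : ∀ᵐ x, Tendsto (fun n => F n x) atTop (nhds (f x)))
    (hg : ∀ᵐ x, Tendsto (fun n => G n x) atTop (nhds (g x))) : HasWeakPartial i f g := by
  have key {F : ℕ → Torus d → ℝ} {f b : Torus d → ℝ} (hi : ∀ n, Integrable (F n))
      (hb : Integrable b) (hF : ∀ n, ∀ᵐ x, ‖F n x‖ ≤ b x)
      (hf : ∀ᵐ x, Tendsto (fun n => F n x) atTop (nhds (f x))) : Integrable f ∧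
      ∀ φ : Torus d → ℝ, Continuous φ →
        Tendsto (fun n => ∫ x, φ x • F n x) atTop (nhds (∫ x, φ x • f x)) := by
    constructor
    · refine hb.mono' (aestronglyMeasurable_of_tendsto_ae atTop (fun n => (hi n).1) hf) ?_
      filter_upwards [hf, ae_all_iff.2 hF] with x hx hx'
      exact le_of_tendsto hx.norm (Eventually.of_forall hx')
    · intro φ hφ
      obtain ⟨C, hC⟩ := exists_bound_of_continuous hφ
      refine tendsto_integral_of_dominated_convergence (fun x => C * b x)
        (fun n => (integrable_smul_of_continuous hφ (hi n)).1) (hb.const_mul C) (fun n => ?_) ?_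
      · filter_upwards [hF n] with x hx
        rw [norm_smul]
        exact mul_le_mul (hC x) hx (norm_nonneg _) ((norm_nonneg _).trans (hC x))
      · filter_upwards [hf] with x hx
        exact hx.const_smul _
  obtain ⟨i1, t1⟩ := key (fun n => (h n).1) hbf hF hf
  obtain ⟨i2, t2⟩ := key (fun n => (h n).2.1) hbg hG hg
  refine ⟨i1, i2, fun φ hφ => ?_⟩
  have hφ1 : IsCn 1 φ := hφ.of_le (by norm_num)
  have l1 := t1 _ (hφ1.continuous_torusPartial le_rfl i)
  have l2 := t2 _ hφ.continuous
  simp_rw [(h _).2.2 φ hφ] at l2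
  exact tendsto_nhds_unique l2 l1.neg

lemma HasWeakPartial.const_mul_real {i : Fin d} {f g : Torus d → ℝ} (h : HasWeakPartial i f g)
    (c : ℝ) : HasWeakPartial i (fun x => c * f x) (fun x => c * g x) := by
  refine ⟨h.1.const_mul c, h.2.1.const_mul c, fun φ hφ => ?_⟩
  have := h.2.2 φ hφ
  simp only [smul_eq_mul, mul_left_comm _ c] at this ⊢
  rw [integral_const_mul, integral_const_mul, this, mul_neg]

lemma memLp_top_pow {u : Torus d → ℝ} (hu : MemLp u ∞ volume) (n : ℕ) :
    MemLp (fun x => u x ^ n) ∞ volume := by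
  induction n with
  | zero => simpa using memLp_const (1 : ℝ)
  | succ n ih => simpa only [pow_succ] using hu.mul' ih

lemma HasWeakPartial.pow {i : Fin d} {u u' : Torus d → ℝ} (hu : MemLp u ∞ volume)
    (hu' : MemLp u' ∞ volume) (h : HasWeakPartial i u u') (n : ℕ) :
    HasWeakPartial i (fun x => u x ^ (n + 1)) (fun x => (n + 1) * u x ^ n * u' x) := by
  induction n with
  | zero => simpa using h
  | succ n ih =>
    have hp : MemLp (fun x => ((n : ℝ) + 1) * u x ^ n * u' x) ∞ volume :=
      hu'.mul' ((memLp_top_pow hu n).const_mul _)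
    have := ih.mul_real (memLp_two_of_memLp_top (memLp_top_pow hu (n + 1)))
      (memLp_two_of_memLp_top hp) (memLp_two_of_memLp_top hu) (memLp_two_of_memLp_top hu') h
    convert this using 1 <;>
    · funext x
      push_cast
      ring

/-- The chain rule holds for polynomials by the product rule, and the Taylor polynomials of `exp`
together with their derivatives are dominated because `u` and `u'` are bounded. -/
lemma HasWeakPartial.exp {i : Fin d} {u u' : Torus d → ℝ} (hu : MemLp u ∞ volume)
    (hu' : MemLp u' ∞ volume) (h : HasWeakPartial i u u') :
    HasWeakPartial i (fun x => Real.exp (u x)) (fun x => Real.exp (u x) * u' x) := by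
  let S (n : ℕ) (t : ℝ) : ℝ := ∑ m ∈ Finset.range n, t ^ m / m.factorial
  have hS (n : ℕ) (t : ℝ) : ‖S n t‖ ≤ Real.exp ‖t‖ := by
    refine le_trans (norm_sum_le _ _) (le_trans (le_of_eq ?_)
      (Real.sum_le_exp_of_nonneg (norm_nonneg t) n))
    simp
  have hlim (t : ℝ) : Tendsto (fun n => S n t) atTop (nhds (Real.exp t)) := by
    have := (NormedSpace.expSeries_div_hasSum_exp t).tendsto_sum_nat
    rwa [← Real.exp_eq_exp_ℝ] at this
  -- Differentiating the partial sum with `n + 1` terms gives the one with `n` terms.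
  have hw (n : ℕ) : HasWeakPartial i (fun x => S (n + 1) (u x)) (fun x => S n (u x) * u' x) := by
    induction n with
    | zero =>
      have := (isCn_const (d := d) 1).of_le (m := 1) (by norm_num) |>.hasWeakPartial i
      simpa [S, funext (torusPartial_const i (1 : ℝ))] using this
    | succ n ih =>
      have := ih.add ((h.pow hu hu' n).const_mul_real (((n + 1).factorial : ℝ)⁻¹))
      convert this using 1
      · funext x
        simp only [S, Finset.sum_range_succ _ (n + 1), Pi.add_apply]
        ring
      · funext x
        simp only [S, Finset.sum_range_succ _ n, Pi.add_apply]
        have h1 : (n.factorial : ℝ) ≠ 0 := by positivity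
        have h2 : (n : ℝ) + 1 ≠ 0 := by positivity
        rw [Nat.factorial_succ]
        push_cast
        field_simp
  obtain ⟨C, hC0, hC⟩ := exists_ae_bound hu
  obtain ⟨C', hC0', hC'⟩ := exists_ae_bound hu'
  refine HasWeakPartial.of_tendsto hw (integrable_const (Real.exp C))
    (integrable_const (Real.exp C * C')) (fun n => ?_) (fun n => ?_) ?_ ?_
  · filter_upwards [hC] with x hx
    exact (hS _ _).trans (Real.exp_le_exp.2 hx)
  · filter_upwards [hC, hC'] with x hx hx'
    rw [norm_mul]
    exact mul_le_mul ((hS _ _).trans (Real.exp_le_exp.2 hx)) hx' (norm_nonneg _) (by positivity)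
  · exact Eventually.of_forall fun x => (hlim _).comp (tendsto_add_atTop_nat 1)
  · exact Eventually.of_forall fun x => (hlim _).mul_const _

end Exp

/-! ### Stationary states are Gibbs densities -/

section Gibbs

variable {d : ℕ} {σ : ℝ} {V W μbar : Torus d → ℝ}

lemma ae_const_of_hasWeakPartial_zero_real {f : Torus d → ℝ} (hf : MemLp f 2 volume)
    (h : ∀ i, HasWeakPartial i f 0) : ∃ c : ℝ, f =ᵐ[volume] fun _ => c := by
  have hfc : MemLp (fun x => (f x : ℂ)) 2 volume := hf.ofReal
  obtain ⟨c, hc⟩ := ae_const_of_hasWeakPartial_zero (f := hfc.toLp _) fun i => by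
    have h1 : HasWeakPartial i (fun x => (f x : ℂ)) (fun x => ((0 : Torus d → ℝ) x : ℂ)) :=
      hasWeakPartial_ofReal.2 (h i)
    have h2 : (fun x => ((0 : Torus d → ℝ) x : ℂ)) =ᵐ[volume] ((0 : TorusL2 d) : Torus d → ℂ) := by
      filter_upwards [Lp.coeFn_zero ℂ 2 (volume : Measure (Torus d))] with x hx
      rw [hx]
      simp
    exact (h1.congr hfc.coeFn_toLp.symm).congr_right h2
  refine ⟨c.re, ?_⟩
  filter_upwards [hc, hfc.coeFn_toLp] with x hx hx'
  rw [← hx, hx', Complex.ofReal_re]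

lemma MemSobolev.integrable {E : Type*} [NormedAddCommGroup E] [NormedSpace ℝ E] {k : ℕ}
    {f : Torus d → E} (h : MemSobolev k 2 f) : Integrable f :=
  integrable_of_memLp_two h.memLp

lemma memLp_top_gradPotential (hV : IsCn 2 V) (hW : MemSobolev 2 ∞ W) (hμ : Integrable μbar)
    (i : Fin d) : MemLp (gradPotential V W μbar i) ∞ volume :=
  (memLp_of_continuous (hV.continuous_torusPartial (by norm_num) i) ∞).add
    (memLp_top_torusConv (hW.memLp_weakPartial i) hμ)

lemma hasWeakPartial_potential (hV : IsCn 2 V) (hW : MemSobolev 2 ∞ W) (hμ : Integrable μbar)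
    (i : Fin d) : HasWeakPartial i (V + torusConv W μbar) (gradPotential V W μbar i) :=
  ((hV.of_le (by norm_num)).hasWeakPartial i).add
    ((hW.hasWeakPartial i).torusConv hW.memLp (hW.memLp_weakPartial i) hμ)

/-- The weak derivative of the `i`-th component of `∇v[μbar]`. -/
noncomputable def hessPotential (V W μbar : Torus d → ℝ) (i : Fin d) : Torus d → ℝ :=
  torusPartial i (torusPartial i V) + torusConv (weakPartial i (weakPartial i W)) μbar

lemma memSobolev_weakPartial {E : Type*} [NormedAddCommGroup E] [NormedSpace ℝ E]
    [CompleteSpace E] {k : ℕ} {p : ℝ≥0∞} {f : Torus d → E} (h : MemSobolev (k + 1) p f)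
    (i : Fin d) : MemSobolev k p (weakPartial i f) := by
  obtain ⟨g, hg, hgk⟩ := h.2 i
  exact hgk.congr (weakPartial_ae_eq hg).symm

lemma memLp_top_hessPotential (hV : IsCn 2 V) (hW : MemSobolev 2 ∞ W) (hμ : Integrable μbar)
    (i : Fin d) : MemLp (hessPotential V W μbar i) ∞ volume :=
  (memLp_of_continuous ((hV.torusPartial i).continuous_torusPartial le_rfl i) ∞).add
    (memLp_top_torusConv ((memSobolev_weakPartial hW i).memLp_weakPartial i) hμ)

lemma hasWeakPartial_gradPotential (hV : IsCn 2 V) (hW : MemSobolev 2 ∞ W)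
    (hμ : Integrable μbar) (i : Fin d) :
    HasWeakPartial i (gradPotential V W μbar i) (hessPotential V W μbar i) :=
  ((hV.torusPartial i).hasWeakPartial i).add
    (((memSobolev_weakPartial hW i).hasWeakPartial i).torusConv (hW.memLp_weakPartial i)
      ((memSobolev_weakPartial hW i).memLp_weakPartial i) hμ)

/-- A stationary state is a Gibbs density; in particular it is bounded above and below. -/
lemma IsStationaryState.exists_bounds (hσ : 0 < σ) (hV : IsCn 2 V) (hW : MemSobolev 2 ∞ W)
    (hμ : IsStationaryState σ V W μbar) :
    ∃ a b : ℝ, 0 < a ∧ 0 < b ∧ ∀ᵐ x, a ≤ μbar x ∧ μbar x ≤ b := by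
  have hint := hμ.memSobolev.integrable
  set g := gradPotential V W μbar with hg
  let u : Torus d → ℝ := fun x => σ⁻¹ * (V + torusConv W μbar) x
  let u' : Fin d → Torus d → ℝ := fun i x => σ⁻¹ * g i x
  have hu : MemLp u ∞ volume :=
    ((memLp_of_continuous hV.continuous ∞).add (memLp_top_torusConv hW.memLp hint)).const_mul _
  have hgi (i : Fin d) : MemLp (g i) ∞ volume := memLp_top_gradPotential hV hW hint i
  have hu' (i : Fin d) : MemLp (u' i) ∞ volume := (hgi i).const_mul _
  have huu (i : Fin d) : HasWeakPartial i u (u' i) :=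
    (hasWeakPartial_potential hV hW hint i).const_mul_real σ⁻¹
  obtain ⟨C, hC0, hC⟩ := exists_ae_bound hu
  let e : Torus d → ℝ := fun x => Real.exp (u x)
  have he : MemLp e ∞ volume := by
    refine MemLp.of_bound (Real.continuous_exp.comp_aestronglyMeasurable hu.1) (Real.exp C) ?_
    filter_upwards [hC] with x hx
    rw [Real.norm_eq_abs, Real.abs_exp]
    exact Real.exp_le_exp.2 ((le_abs_self _).trans hx)
  -- For a Gibbs density `μbar exp(v/σ)` is constant. The gradient `w'` of `w` is `σ⁻¹ exp(v/σ)`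
  -- times the stationary flux `F`.
  let w : Torus d → ℝ := fun x => μbar x * e x
  let F : Fin d → Torus d → ℝ := fun i x => σ * weakPartial i μbar x + μbar x * g i x
  let w' : Fin d → Torus d → ℝ := fun i x => σ⁻¹ * e x * F i x
  have hμ2 := hμ.memSobolev.memLp
  have hμ2' (i : Fin d) := hμ.memSobolev.memLp_weakPartial i
  have hF (i : Fin d) : MemLp (F i) 2 volume := by
    have h1 : MemLp (fun x => μbar x * g i x) 2 volume := (hgi i).mul' hμ2
    exact ((hμ2' i).const_mul σ).add h1
  have hw2 : MemLp w 2 volume := he.mul' hμ2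
  have hw2' (i : Fin d) : MemLp (w' i) 2 volume := (hF i).mul' (he.const_mul σ⁻¹)
  have hww (i : Fin d) : HasWeakPartial i w (w' i) := by
    have h1 : MemLp (fun x => e x * u' i x) ∞ volume := (hu' i).mul' he
    have := (hμ.memSobolev.hasWeakPartial i).mul_real hμ2 (hμ2' i) (memLp_two_of_memLp_top he)
      (memLp_two_of_memLp_top h1) ((huu i).exp hu (hu' i))
    convert this using 1
    funext x
    simp only [w', F, e, u']
    field_simp
  have hwS : MemSobolev 1 2 w := ⟨hw2, fun i => ⟨w' i, hww i, hw2' i⟩⟩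
  -- Testing stationarity with `w` itself makes the integrand a weighted sum of squares of the flux,
  -- so the flux vanishes and `w` has zero gradient.
  have hzero : ∫ x, ∑ i, σ⁻¹ * e x * F i x ^ 2 = 0 := by
    rw [← hμ.weak_eq w hwS]
    refine integral_congr_ae ?_
    filter_upwards [ae_all_iff.2 fun i => weakPartial_ae_eq (hww i)] with x hx
    refine Finset.sum_congr rfl fun i _ => ?_
    rw [hx i]
    simp only [w', F, hg]
    ring
  have hnn (i : Fin d) (x : Torus d) : 0 ≤ σ⁻¹ * e x * F i x ^ 2 := by
    have : 0 < e x := Real.exp_pos _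
    positivity
  have hi (i : Fin d) : Integrable fun x => σ⁻¹ * e x * F i x ^ 2 := by
    have := (hF i).integrable_mul (hw2' i)
    refine this.congr (Eventually.of_forall fun x => ?_)
    simp only [w', Pi.mul_apply]
    ring
  have hae := (integral_eq_zero_iff_of_nonneg (fun x => Finset.sum_nonneg fun i _ => hnn i x)
    (integrable_finsetSum _ fun i _ => hi i)).1 hzero
  have hw0 (i : Fin d) : HasWeakPartial i w 0 := by
    refine (hww i).congr_right ?_
    filter_upwards [hae] with x hx
    have h1 := (Finset.sum_eq_zero_iff_of_nonneg fun i _ => hnn i x).1 hx i (Finset.mem_univ i)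
    have h2 : σ⁻¹ * e x ≠ 0 := mul_ne_zero (inv_ne_zero hσ.ne') (Real.exp_pos _).ne'
    have h3 : F i x = 0 := by
      rcases mul_eq_zero.1 h1 with h | h
      · exact absurd h h2
      · exact pow_eq_zero_iff (by norm_num) |>.1 h
    simp only [w', h3, mul_zero, Pi.zero_apply]
  obtain ⟨c, hc⟩ := ae_const_of_hasWeakPartial_zero_real hw2 hw0
  have hμc : ∀ᵐ x, μbar x = c * Real.exp (-u x) := by
    filter_upwards [hc] with x hx
    rw [← hx]
    simp only [w, e, mul_assoc, ← Real.exp_add, add_neg_cancel, Real.exp_zero, mul_one]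
  have hvol : (volume : Measure (Torus d)) ≠ 0 := NeZero.ne _
  have : (ae (volume : Measure (Torus d))).NeBot := ae_neBot.2 hvol
  -- Nonnegativity of `μbar` gives `0 ≤ c`, and total mass one excludes `c = 0`.
  have hc0 : 0 < c := by
    have h0 : 0 ≤ c := by
      obtain ⟨x, hx, hx'⟩ := (hμc.and hμ.nonneg).exists
      rw [hx] at hx'
      exact nonneg_of_mul_nonneg_left hx' (Real.exp_pos _)
    refine lt_of_le_of_ne h0 fun h => ?_
    have h1 : μbar =ᵐ[volume] 0 := by
      filter_upwards [hμc] with x hx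
      rw [hx, ← h, zero_mul, Pi.zero_apply]
    have h2 := hμ.integral_eq_one
    rw [integral_congr_ae h1] at h2
    simp at h2
  refine ⟨c * Real.exp (-C), c * Real.exp C, by positivity, by positivity, ?_⟩
  filter_upwards [hμc, hC] with x hx hx'
  rw [Real.norm_eq_abs, abs_le] at hx'
  rw [hx]
  constructor
  · gcongr; exact hx'.2
  · gcongr; linarith [hx'.1]

end Gibbs

/-! ### Compact operators and operators with compact resolvent -/

section CompactSpectrum

variable {X : Type*} [NormedAddCommGroup X] [NormedSpace ℂ X]

open Module.End in
/-- A compact operator has finitely many eigenvalues away from zero. -/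
lemma finite_eigenvalues_of_isCompactOperator {K : X →L[ℂ] X} (hK : IsCompactOperator K) {c : ℝ}
    (hc : 0 < c) : {a : ℂ | HasEigenvalue (K : Module.End ℂ X) a ∧ c ≤ ‖a‖}.Finite := by
  by_contra hinf
  let ν : ℕ → ℂ := fun n => (Set.Infinite.natEmbedding _ hinf n : ℂ)
  have hνinj : Function.Injective ν :=
    Subtype.coe_injective.comp (Set.Infinite.natEmbedding _ hinf).injective
  have hν (n : ℕ) : HasEigenvalue (K : Module.End ℂ X) (ν n) ∧ c ≤ ‖ν n‖ :=
    (Set.Infinite.natEmbedding _ hinf n).2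
  choose v hv using fun n => (hν n).1.exists_hasEigenvector
  have hli : LinearIndependent ℂ v := eigenvectors_linearIndependent' _ ν hνinj v hv
  -- Riesz's argument: infinitely many distinct eigenvalues give a strictly increasing chain of
  -- invariant subspaces `E n`, and `K - ν n` maps `E (n + 1)` into `E n`.
  let E : ℕ → Submodule ℂ X := fun n => Submodule.span ℂ (v '' Set.Iio n)
  have hEmono {m n : ℕ} (h : m ≤ n) : E m ≤ E n :=
    Submodule.span_mono (Set.image_mono (Set.Iio_subset_Iio h))
  have hvE {m n : ℕ} (h : m < n) : v m ∈ E n := Submodule.subset_span ⟨m, h, rfl⟩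
  have hKv (n : ℕ) : K (v n) = ν n • v n := (hv n).apply_eq_smul
  have hKE {n : ℕ} {x : X} (hx : x ∈ E n) : K x ∈ E n := by
    have : E n ≤ (E n).comap (K : X →ₗ[ℂ] X) := by
      refine Submodule.span_le.2 ?_
      rintro _ ⟨m, hm, rfl⟩
      change K (v m) ∈ E n
      rw [hKv]
      exact Submodule.smul_mem _ _ (hvE hm)
    exact this hx
  have hKν {n : ℕ} {x : X} (hx : x ∈ E (n + 1)) : K x - ν n • x ∈ E n := by
    have : E (n + 1) ≤ (E n).comap ((K : X →ₗ[ℂ] X) - ν n • LinearMap.id) := by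
      refine Submodule.span_le.2 ?_
      rintro _ ⟨m, hm, rfl⟩
      change K (v m) - ν n • v m ∈ E n
      rw [hKv, ← sub_smul]
      rcases (Nat.lt_succ_iff.1 hm).lt_or_eq with h | h
      · exact Submodule.smul_mem _ _ (hvE h)
      · rw [h, sub_self, zero_smul]
        exact Submodule.zero_mem _
    exact this hx
  have hx (n : ℕ) : ∃ x ∈ E (n + 1), ‖x‖ ≤ 3 ∧ ∀ y ∈ E n, 1 ≤ ‖x - y‖ := by
    have : FiniteDimensional ℂ (E n) :=
      FiniteDimensional.span_of_finite ℂ ((Set.finite_Iio n).image v)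
    have h1 : IsClosed ((E n).comap (E (n + 1)).subtype : Set (E (n + 1))) :=
      (Submodule.closed_of_finiteDimensional (E n)).preimage continuous_subtype_val
    have h2 : ∃ x : E (n + 1), x ∉ (E n).comap (E (n + 1)).subtype := by
      refine ⟨⟨v n, hvE n.lt_succ_self⟩, fun h => ?_⟩
      exact hli.notMem_span_image (s := Set.Iio n) (x := n) (by simp) h
    -- Any scalar `c` and radius `R` with `1 < ‖c‖ < R` would do; only boundedness of the sequence
    -- and distance at least one from `E n` matter.
    obtain ⟨⟨x, hx⟩, hxn, hxy⟩ := riesz_lemma_of_norm_lt (𝕜 := ℂ) (c := 2) (R := 3)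
      (by norm_num) (by norm_num) h1 h2
    exact ⟨x, hx, hxn, fun y hy => hxy ⟨y, hEmono n.le_succ hy⟩ hy⟩
  choose x hxE hxn hxy using hx
  -- Up to the factor `ν n`, the difference is `x n` minus an element of `E n`. The images are thus
  -- uniformly separated, which contradicts compactness of `K`.
  have hsep {m n : ℕ} (h : m < n) : c ≤ ‖K (x n) - K (x m)‖ := by
    have hν0 : ν n ≠ 0 := norm_pos_iff.1 (hc.trans_le (hν n).2)
    have hmem : K (x m) - (K (x n) - ν n • x n) ∈ E n :=
      Submodule.sub_mem _ (hKE (hEmono h (hxE m))) (hKν (hxE n))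
    have e : K (x n) - K (x m)
        = ν n • (x n - (ν n)⁻¹ • (K (x m) - (K (x n) - ν n • x n))) := by
      rw [smul_sub, smul_inv_smul₀ hν0]
      abel
    rw [e, norm_smul]
    calc c = c * 1 := (mul_one c).symm
      _ ≤ _ := mul_le_mul (hν n).2 (hxy n _ (Submodule.smul_mem _ _ hmem)) zero_le_one
        (norm_nonneg _)
  obtain ⟨S, hS, hS'⟩ := hK.image_closedBall_subset_compact 3
  obtain ⟨y, -, ψ, hψ, hψy⟩ := hS.tendsto_subseq (x := fun n => K (x n))
    (fun n => hS' ⟨x n, by simpa using hxn n, rfl⟩)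
  obtain ⟨N, hN⟩ := Metric.cauchySeq_iff'.1 hψy.cauchySeq c hc
  have h1 := hN (N + 1) (by omega)
  rw [dist_eq_norm] at h1
  exact absurd (hsep (hψ N.lt_succ_self)) (not_le.2 h1)

/-- Working with the graph avoids carrying domain membership proofs: `T (R f)` must equal `z • R f -
f`. -/
lemma mem_opResolventSet_of_graph {T : X →ₗ.[ℂ] X} {z : ℂ} (R : X →L[ℂ] X)
    (h1 : ∀ f, (R f, z • R f - f) ∈ T.graph) (h2 : ∀ p ∈ T.graph, R (z • p.1 - p.2) = p.1) :
    z ∈ opResolventSet T := by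
  refine ⟨R, fun f => ⟨LinearPMap.mem_domain_of_mem_graph (h1 f), ?_⟩, fun y => ?_⟩
  · rw [← (LinearPMap.image_iff (LinearPMap.mem_domain_of_mem_graph (h1 f))).2 (h1 f)]
    abel
  · exact h2 _ (T.mem_graph y)

/-- The spectrum of an operator with compact resolvent is discrete. -/
lemma finite_opSpectrum_inter_of_isCompactOperator [CompleteSpace X] {T : X →ₗ.[ℂ] X} {z₀ : ℂ}
    {R : X →L[ℂ] X} (hR : IsCompactOperator R)
    (h1 : ∀ f, (R f, z₀ • R f - f) ∈ T.graph) (h2 : ∀ p ∈ T.graph, R (z₀ • p.1 - p.2) = p.1)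
    {S : Set ℂ} (hS : Bornology.IsBounded S) : (opSpectrum T ∩ S).Finite := by
  obtain ⟨D, hD⟩ := hS.subset_ball z₀
  have hinj : Function.Injective fun z : ℂ => (z₀ - z)⁻¹ := fun a b h => by
    simpa using h
  -- The radius `D` may be nonpositive; the maximum gives a positive lower bound for `‖(z₀ - z)⁻¹‖`.
  have hD0 : 0 < max D 1 := by positivity
  refine ((finite_eigenvalues_of_isCompactOperator hR (inv_pos.2 hD0)).preimage
    hinj.injOn).subset ?_
  rintro z ⟨hz, hzS⟩
  have hne : z₀ - z ≠ 0 := by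
    intro h
    rw [← sub_eq_zero.1 h] at hz
    exact hz (mem_opResolventSet_of_graph R h1 h2)
  refine ⟨?_, ?_⟩
  -- Fredholm alternative at `a = (z₀ - z)⁻¹`. On the range of `R` one has `(z - T) R = a⁻¹ (a -
  -- R)`, so if `a - R` is invertible then `a R (a - R)⁻¹` inverts `z - T`.
  · refine (hR.hasEigenvalue_or_mem_resolventSet (inv_ne_zero hne)).resolve_right fun hmem => hz ?_
    obtain ⟨u, hu⟩ := spectrum.mem_resolventSet_iff.1 hmem
    rw [Algebra.algebraMap_eq_smul_one] at hu
    set a := (z₀ - z)⁻¹ with ha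
    have ha0 : a ≠ 0 := inv_ne_zero hne
    have hza : z = z₀ - a⁻¹ := by rw [ha, inv_inv]; ring
    have hcomm : (R : X →L[ℂ] X) * ↑u⁻¹ = ↑u⁻¹ * R := by
      have hRu : Commute R (u : X →L[ℂ] X) := by
        rw [hu]
        exact ((Commute.one_right R).smul_right a).sub_right (Commute.refl R)
      exact hRu.units_inv_right
    have huv (x : X) : a • (↑u⁻¹ : X →L[ℂ] X) x - R ((↑u⁻¹ : X →L[ℂ] X) x) = x := by
      have := congrArg (fun A : X →L[ℂ] X => A x) (u.mul_inv)
      rw [hu] at this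
      simpa using this
    have hvu (x : X) : a • (↑u⁻¹ : X →L[ℂ] X) x - (↑u⁻¹ : X →L[ℂ] X) (R x) = x := by
      have := congrArg (fun A : X →L[ℂ] X => A x) (u.inv_mul)
      rw [hu] at this
      simpa using this
    have hcx (x : X) : R ((↑u⁻¹ : X →L[ℂ] X) x) = (↑u⁻¹ : X →L[ℂ] X) (R x) :=
      congrArg (fun A : X →L[ℂ] X => A x) hcomm
    refine mem_opResolventSet_of_graph (a • (R * ↑u⁻¹)) (fun f => ?_) (fun p hp => ?_)
    · have := h1 (a • (↑u⁻¹ : X →L[ℂ] X) f)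
      convert this using 2
      · simp
      · have e : z • (a • (R * ↑u⁻¹ : X →L[ℂ] X)) f = (z₀ * a - 1) • R ((↑u⁻¹ : X →L[ℂ] X) f) := by
          rw [smul_apply, mul_apply_eq_comp, smul_smul, hza, sub_mul, inv_mul_cancel₀ ha0]
        rw [e, map_smul]
        linear_combination (norm := module) huv f
    · have := h2 p hp
      have e : z • p.1 - p.2 = (z₀ • p.1 - p.2) - a⁻¹ • p.1 := by
        rw [hza, sub_smul]; abel
      simp only [smul_apply, mul_apply_eq_comp]
      rw [hcx, e, map_sub, this, map_smul, map_sub, smul_sub, map_smul, smul_inv_smul₀ ha0]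
      exact hvu _
  · rw [norm_inv]
    have h3 := hD hzS
    rw [Metric.mem_ball, dist_comm, dist_eq_norm] at h3
    exact inv_anti₀ (norm_pos_iff.2 hne) (h3.le.trans (le_max_left _ _))

end CompactSpectrum

/-! ### Fourier multipliers -/

section Multiplier

variable {d : ℕ}

/-- `M` is the Fourier multiplier on `L²(𝕋^d)` with symbol `m`. -/
def IsFourierMultiplier (m : (Fin d → ℤ) → ℂ) (M : TorusL2 d →L[ℂ] TorusL2 d) : Prop :=
  ∀ f k, (modeBasis d).repr (M f) k = m k * (modeBasis d).repr f k

lemma ext_repr {f g : TorusL2 d} (h : ∀ k, (modeBasis d).repr f k = (modeBasis d).repr g k) :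
    f = g := (modeBasis d).repr.injective (lp.ext (funext h))

lemma IsFourierMultiplier.unique {m : (Fin d → ℤ) → ℂ} {M M' : TorusL2 d →L[ℂ] TorusL2 d}
    (h : IsFourierMultiplier m M) (h' : IsFourierMultiplier m M') : M = M' :=
  ContinuousLinearMap.ext fun f => ext_repr fun k => by rw [h, h']

/-- Transported by the Fourier isometry, this is multiplication of `ℓ²` by a bounded sequence,
bounded by Hölder with exponents `∞` and `2`. -/
lemma exists_isFourierMultiplier {m : (Fin d → ℤ) → ℂ} {C : ℝ} (hm : ∀ k, ‖m k‖ ≤ C) :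
    ∃ M, IsFourierMultiplier m M ∧ ‖M‖ ≤ C := by
  have hC : 0 ≤ C := (norm_nonneg _).trans (hm 0)
  let m' : lp (fun _ : Fin d → ℤ => ℂ) ∞ :=
    ⟨m, memℓp_infty ⟨C, by rintro _ ⟨k, rfl⟩; exact hm k⟩⟩
  have hm' : ‖m'‖ ≤ C := lp.norm_le_of_forall_le hC hm
  let B := lp.holderL (p := ∞) (q := 2) (𝕜 := ℂ) 2
    (fun _ : Fin d → ℤ => ContinuousLinearMap.mul ℂ ℂ) (K := 1) fun _ => by simp
  have hB : ‖B m'‖ ≤ C := by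
    refine (B.le_opNorm m').trans ?_
    calc ‖B‖ * ‖m'‖ ≤ 1 * C := by
          gcongr
          simpa using lp.norm_holderL_le (p := ∞) (q := 2) (𝕜 := ℂ) 2
            (fun _ : Fin d → ℤ => ContinuousLinearMap.mul ℂ ℂ) (K := 1) fun _ => by simp
      _ = C := one_mul C
  let b := (modeBasis d).repr
  refine ⟨(b.symm.toContinuousLinearEquiv : _ →L[ℂ] TorusL2 d) ∘L (B m') ∘L
    (b.toContinuousLinearEquiv : TorusL2 d →L[ℂ] _), fun f k => ?_, ?_⟩
  · change b (b.symm (B m' (b f))) k = m k * b f k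
    rw [LinearIsometryEquiv.apply_symm_apply]
    rfl
  · refine ContinuousLinearMap.opNorm_le_bound _ hC fun f => ?_
    change ‖b.symm (B m' (b f))‖ ≤ C * ‖f‖
    rw [LinearIsometryEquiv.norm_map, ← b.norm_map f]
    exact (B m').le_of_opNorm_le hB _

lemma IsFourierMultiplier.norm_le {m : (Fin d → ℤ) → ℂ} {M : TorusL2 d →L[ℂ] TorusL2 d}
    (h : IsFourierMultiplier m M) {C : ℝ} (hm : ∀ k, ‖m k‖ ≤ C) : ‖M‖ ≤ C := by
  obtain ⟨M', hM', hC⟩ := exists_isFourierMultiplier hm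
  rwa [h.unique hM']

lemma IsFourierMultiplier.sub {m m' : (Fin d → ℤ) → ℂ} {M M' : TorusL2 d →L[ℂ] TorusL2 d}
    (h : IsFourierMultiplier m M) (h' : IsFourierMultiplier m' M') :
    IsFourierMultiplier (m - m') (M - M') := by
  intro f k
  rw [sub_apply, map_sub, lp.coeFn_sub, Pi.sub_apply, h, h', Pi.sub_apply]
  ring

/-- Finitely supported symbols give finite sums of rank-one operators. They approximate multipliers
whose symbols vanish at infinity. -/
lemma exists_isCompactOperator_multiplier (m : (Fin d → ℤ) → ℂ) (F : Finset (Fin d → ℤ)) :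
    ∃ M, IsFourierMultiplier (fun k => if k ∈ F then m k else 0) M ∧ IsCompactOperator M := by
  classical
  induction F using Finset.induction_on with
  | empty =>
    refine ⟨0, fun f k => ?_, isCompactOperator_zero⟩
    simp
  | insert l F hl ih =>
    obtain ⟨M, hM, hMc⟩ := ih
    let b := modeBasis d
    let P : TorusL2 d →L[ℂ] TorusL2 d :=
      (ContinuousLinearMap.toSpanSingleton ℂ (m l • b l)) ∘L (innerSL ℂ (b l))
    have hQ : IsCompactOperator (ContinuousLinearMap.toSpanSingleton ℂ (m l • b l)) :=
      isCompactOperator_of_locallyCompactSpace_rng _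
    have hP : IsCompactOperator P := hQ.comp_clm (innerSL ℂ (b l))
    refine ⟨M + P, fun f k => ?_, hMc.add hP⟩
    have e : P f = (b.repr f l * m l) • b l := by
      change (inner ℂ (b l) f) • (m l • b l) = _
      rw [smul_smul, ← HilbertBasis.repr_apply_apply]
    rw [add_apply, map_add, lp.coeFn_add, Pi.add_apply, hM, e, map_smul, lp.coeFn_smul,
      Pi.smul_apply, HilbertBasis.repr_self]
    by_cases hk : k = l
    · subst hk
      simp [hl, mul_comm, b]
    · simp [hk, lp.single_apply]

/-- A Fourier multiplier whose symbol vanishes at infinity is compact. -/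
lemma IsFourierMultiplier.isCompactOperator {m : (Fin d → ℤ) → ℂ} {M : TorusL2 d →L[ℂ] TorusL2 d}
    (h : IsFourierMultiplier m M) (hm : Tendsto m cofinite (nhds 0)) : IsCompactOperator M := by
  choose A hA hAc using exists_isCompactOperator_multiplier m
  refine isCompactOperator_of_tendsto (l := atTop) (F := A) ?_ (Eventually.of_forall hAc)
  rw [Metric.tendsto_atTop]
  intro ε hε
  -- Off this finite set the symbol is below `ε / 2`, so truncation there costs at most `ε / 2` in
  -- operator norm.
  have hfin := Metric.tendsto_nhds.1 hm (ε / 2) (by positivity)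
  rw [eventually_cofinite] at hfin
  refine ⟨hfin.toFinset, fun F hF => ?_⟩
  rw [dist_comm, dist_eq_norm]
  refine lt_of_le_of_lt ((h.sub (hA F)).norm_le (C := ε / 2) fun k => ?_) (by linarith)
  by_cases hk : k ∈ F
  · simpa [hk] using (half_pos hε).le
  · have : k ∉ hfin.toFinset := fun h' => hk (hF h')
    simp only [Set.Finite.mem_toFinset, Set.mem_ofPred_eq, not_not, dist_zero_right] at this
    simpa [hk] using this.le

end Multiplier

/-! ### Estimates for the symbol `z + σ|k|²` -/

section Symbol

variable {d : ℕ}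

/-- The symbol of `z - σΔ`. -/
noncomputable def resolventSymbol (σ : ℝ) (z : ℂ) (k : Fin d → ℤ) : ℂ :=
  z + ((σ * ∑ i, (k i : ℝ) ^ 2 : ℝ) : ℂ)

/-- After the shift `w = z + δ` the real part is nonnegative, so adding `σ|k|²` does not decrease
the modulus. This gives `2‖symbol‖ ≥ ‖z‖ - 3δ + σ|k|²` uniformly in `k`. Large `‖z‖` controls the
constant, and the quadratic term absorbs `|k i|`. -/
lemma exists_symbol_bound {σ δ : ℝ} (hσ : 0 < σ) (hδ : 0 < δ) {ε : ℝ} (hε : 0 < ε) :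
    ∃ ρ : ℝ, ∀ z : ℂ, -δ ≤ z.re → ρ ≤ ‖z‖ → ∀ k : Fin d → ℤ,
      1 ≤ ε * ‖resolventSymbol σ z k‖ ∧ ∀ i, |(k i : ℝ)| ≤ ε * ‖resolventSymbol σ z k‖ := by
  -- The `3δ` pays for the shift; the rest, after multiplication by `ε / 2`, leaves `1` for the
  -- first bound and `1 / (2εσ)` for the Young inequality in the second.
  refine ⟨3 * δ + 2 / ε * (1 + 1 / (2 * ε * σ)), fun z hz hρ k => ?_⟩
  set q : ℝ := ∑ i, (k i : ℝ) ^ 2 with hq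
  have hq0 : 0 ≤ q := Finset.sum_nonneg fun i _ => sq_nonneg _
  have hs : 0 ≤ σ * q := by positivity
  set w : ℂ := z + δ with hw
  have hwre : 0 ≤ w.re := by simp [hw]; linarith
  have e : resolventSymbol σ z k = (w + ((σ * q : ℝ) : ℂ)) - (δ : ℂ) := by
    simp only [resolventSymbol, hw, hq]; ring
  have n1 : ‖w + ((σ * q : ℝ) : ℂ)‖ - δ ≤ ‖resolventSymbol σ z k‖ := by
    rw [e]
    refine le_trans (le_of_eq ?_) (norm_sub_norm_le _ _)
    rw [Complex.norm_real, Real.norm_of_nonneg hδ.le]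
  have n2 : σ * q ≤ ‖w + ((σ * q : ℝ) : ℂ)‖ := by
    refine le_trans ?_ ((le_abs_self _).trans (Complex.abs_re_le_norm _))
    rw [Complex.add_re, Complex.ofReal_re]
    linarith
  have n3 : ‖w‖ ≤ ‖w + ((σ * q : ℝ) : ℂ)‖ := by
    rw [← sq_le_sq₀ (norm_nonneg _) (norm_nonneg _), ← Complex.normSq_eq_norm_sq,
      ← Complex.normSq_eq_norm_sq, Complex.normSq_apply, Complex.normSq_apply, Complex.add_re w,
      Complex.add_im w, Complex.ofReal_re, Complex.ofReal_im]
    nlinarith [mul_nonneg hwre hs]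
  have n4 : ‖z‖ - δ ≤ ‖w‖ := by
    have := norm_sub_norm_le z (-(δ : ℂ))
    rw [norm_neg, Complex.norm_real, Real.norm_of_nonneg hδ.le, sub_neg_eq_add] at this
    exact this
  have main : 1 + 1 / (2 * ε * σ) + ε * σ * q / 2 ≤ ε * ‖resolventSymbol σ z k‖ := by
    have h1 : 2 / ε * (1 + 1 / (2 * ε * σ)) + σ * q ≤ 2 * ‖resolventSymbol σ z k‖ := by linarith
    have h2 := mul_le_mul_of_nonneg_left h1 (half_pos hε).le
    have h3 : ε / 2 * (2 / ε * (1 + 1 / (2 * ε * σ)) + σ * q)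
        = 1 + 1 / (2 * ε * σ) + ε * σ * q / 2 := by field_simp
    linarith
  have hp : 0 < 1 / (2 * ε * σ) := by positivity
  have hp2 : 0 ≤ ε * σ * q / 2 := by positivity
  refine ⟨by linarith, fun i => ?_⟩
  have hkq : |(k i : ℝ)| ^ 2 ≤ q := by
    rw [sq_abs]
    exact Finset.single_le_sum (f := fun i => (k i : ℝ) ^ 2) (fun i _ => sq_nonneg _)
      (Finset.mem_univ i)
  set t := |(k i : ℝ)|
  -- Young's inequality, as a completed square.
  have h5 : t ≤ 1 / (2 * ε * σ) + ε * σ * t ^ 2 / 2 := by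
    have : 1 / (2 * ε * σ) + ε * σ * t ^ 2 / 2 - t = (ε * σ * t - 1) ^ 2 / (2 * ε * σ) := by
      field_simp; ring
    have h6 : 0 ≤ (ε * σ * t - 1) ^ 2 / (2 * ε * σ) := by positivity
    linarith
  have h7 : ε * σ * t ^ 2 / 2 ≤ ε * σ * q / 2 := by gcongr
  linarith

lemma tendsto_inv_symbol {σ : ℝ} {z : ℂ} {ε : ℝ}
    (h : ∀ k : Fin d → ℤ, 1 ≤ ε * ‖resolventSymbol σ z k‖ ∧
      ∀ i, |(k i : ℝ)| ≤ ε * ‖resolventSymbol σ z k‖) :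
    Tendsto (fun k : Fin d → ℤ => (resolventSymbol σ z k)⁻¹) cofinite (nhds 0) := by
  -- Positivity is forced by the first bound at `k = 0`.
  have hε : 0 < ε := by
    by_contra hn
    have := (h 0).1
    nlinarith [norm_nonneg (resolventSymbol σ z (0 : Fin d → ℤ))]
  rw [Metric.tendsto_nhds]
  intro η hη
  rw [eventually_cofinite]
  -- If the inverse symbol is at least `η` in modulus, every `|k i|` is at most `ε / η`; only
  -- finitely many `k` qualify.
  let N : ℤ := ⌈ε / η⌉
  refine (Set.finite_Icc (fun _ : Fin d => -N) (fun _ => N)).subset fun k hk => ?_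
  simp only [dist_zero_right, norm_inv, Set.mem_ofPred_eq, not_lt] at hk
  have h1 : ‖resolventSymbol σ z k‖ ≤ η⁻¹ := by
    rwa [le_inv_comm₀ hη] at hk
    by_contra hn
    have := (h k).1
    nlinarith
  have h2 (i : Fin d) : |k i| ≤ N := by
    have h3 : |(k i : ℝ)| ≤ ε / η := ((h k).2 i).trans (by rw [div_eq_mul_inv]; gcongr)
    have h4 : (|k i| : ℝ) ≤ N := h3.trans (Int.le_ceil _)
    exact_mod_cast h4
  exact ⟨fun i => (abs_le.1 (h2 i)).1, fun i => (abs_le.1 (h2 i)).2⟩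

end Symbol

/-! ### Bounded operators for the lower-order terms -/

section Operators

/-- A bounded linear map between `L²` spaces, from a pointwise description. -/
lemma exists_clm_of_ae {α β : Type*} [MeasurableSpace α] [MeasurableSpace β] {μ : Measure α}
    {ν : Measure β} (S : Lp ℂ 2 μ → β → ℂ) (hS : ∀ y, MemLp (S y) 2 ν)
    (hadd : ∀ y y', S (y + y') =ᵐ[ν] S y + S y') (hsmul : ∀ (c : ℂ) y, S (c • y) =ᵐ[ν] c • S y)
    (C : ℝ) (hC : ∀ y, ‖(hS y).toLp (S y)‖ ≤ C * ‖y‖) :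
    ∃ A : Lp ℂ 2 μ →L[ℂ] Lp ℂ 2 ν, ∀ y, A y =ᵐ[ν] S y :=
  ⟨LinearMap.mkContinuous
    { toFun := fun y => (hS y).toLp (S y)
      map_add' := fun y y' => by
        rw [← MemLp.toLp_add]
        exact MemLp.toLp_congr _ _ (hadd y y')
      map_smul' := fun c y => by
        rw [RingHom.id_apply, ← MemLp.toLp_const_smul]
        exact MemLp.toLp_congr _ _ (hsmul c y) } C hC, fun y => (hS y).coeFn_toLp⟩

variable {d : ℕ}

lemma exists_clm_mul {g : Torus d → ℝ} (hg : MemLp g ∞ volume) :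
    ∃ A : TorusL2 d →L[ℂ] TorusL2 d, ∀ y, A y =ᵐ[volume] fun x => (g x : ℂ) * y x := by
  obtain ⟨C, hC0, hC⟩ := exists_ae_bound hg
  have hS (y : TorusL2 d) : MemLp (fun x => (g x : ℂ) * y x) 2 volume :=
    (Lp.memLp y).mul' (p := ∞) hg.ofReal
  refine exists_clm_of_ae (fun y x => (g x : ℂ) * y x) hS (fun y y' => ?_) (fun c y => ?_) C
    (fun y => Lp.norm_le_mul_norm_of_ae_le_mul ?_)
  · filter_upwards [Lp.coeFn_add y y'] with x hx
    rw [hx, Pi.add_apply, Pi.add_apply, mul_add]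
  · filter_upwards [Lp.coeFn_smul c y] with x hx
    rw [hx, Pi.smul_apply, Pi.smul_apply, smul_eq_mul, smul_eq_mul]
    ring
  · filter_upwards [(hS y).coeFn_toLp, hC] with x hx hx'
    rw [hx, norm_mul, Complex.norm_real]
    gcongr

/-- Hölder against the constant `1` on a space of finite measure. -/
lemma integral_norm_le_norm (y : TorusL2 d) :
    ∫ x, ‖y x‖ ≤ (volume (Set.univ : Set (Torus d)) ^ (1 / 2 : ℝ)).toReal * ‖y‖ := by
  have h := eLpNorm_le_eLpNorm_mul_rpow_measure_univ (p := 1) (q := 2) (by norm_num)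
    (Lp.memLp y).1
  rw [integral_norm_eq_lintegral_enorm (Lp.memLp y).1, ← eLpNorm_one_eq_lintegral_enorm,
    Lp.norm_def, ← ENNReal.toReal_mul]
  have e : (1 / (1 : ℝ≥0∞).toReal - 1 / (2 : ℝ≥0∞).toReal) = (1 / 2 : ℝ) := by norm_num
  rw [e, mul_comm (eLpNorm _ _ _)] at h
  refine ENNReal.toReal_mono (ENNReal.mul_ne_top ?_ (Lp.memLp y).2.ne) h
  exact ENNReal.rpow_ne_top_of_nonneg (by norm_num) (measure_ne_top _ _)

lemma torusConv_add_right {K : Torus d → ℝ} (hK : MemLp K ∞ volume) {y y' : Torus d → ℂ}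
    (hy : Integrable y) (hy' : Integrable y') :
    torusConv K (y + y') = torusConv K y + torusConv K y' :=
  (convolutionExists_of_memLp_top hK hy).distrib_add (convolutionExists_of_memLp_top hK hy')

lemma torusConv_smul_right (K : Torus d → ℝ) (c : ℂ) (y : Torus d → ℂ) :
    torusConv K (c • y) = c • torusConv K y := by
  funext x
  simp only [torusConv, convolution_def, ContinuousLinearMap.lsmul_apply, Pi.smul_apply,
    smul_comm _ c]
  exact integral_smul _ _

lemma torusConv_congr_right (K : Torus d → ℝ) {y y' : Torus d → ℂ} (h : y =ᵐ[volume] y') :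
    torusConv K y = torusConv K y' :=
  convolution_congr _ (ae_eq_refl _) h

/-- The convolution is bounded uniformly by `‖K‖_∞ ‖y‖₁`, so the factor `m` need only lie in `L²`.
This accommodates `∂ᵢμbar`, about which only square integrability is known. -/
lemma exists_clm_mul_torusConv {m K : Torus d → ℝ} (hm : MemLp m 2 volume)
    (hK : MemLp K ∞ volume) :
    ∃ A : TorusL2 d →L[ℂ] TorusL2 d, ∀ y : TorusL2 d,
      A y =ᵐ[volume] fun x => (m x : ℂ) * torusConv K y x := by
  obtain ⟨C, hC0, hC⟩ := exists_ae_bound hK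
  have hint (y : TorusL2 d) : Integrable y := integrable_of_memLp_two (Lp.memLp y)
  have hmc : MemLp (fun x => (m x : ℂ)) 2 volume := hm.ofReal
  have hS (y : TorusL2 d) : MemLp (fun x => (m x : ℂ) * torusConv K y x) 2 volume :=
    (memLp_top_torusConv hK (hint y)).mul' hmc
  let D := (volume (Set.univ : Set (Torus d)) ^ (1 / 2 : ℝ)).toReal
  refine exists_clm_of_ae (fun y x => (m x : ℂ) * torusConv K y x) hS (fun y y' => ?_)
    (fun c y => ?_) (C * D * ‖hmc.toLp _‖) (fun y => ?_)
  · rw [torusConv_congr_right K (Lp.coeFn_add y y'), torusConv_add_right hK (hint y) (hint y')]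
    exact Eventually.of_forall fun x => mul_add _ _ _
  · rw [torusConv_congr_right K (Lp.coeFn_smul c y), torusConv_smul_right]
    exact Eventually.of_forall fun x => mul_left_comm _ _ _
  · have : C * D * ‖hmc.toLp _‖ * ‖y‖ = (C * (D * ‖y‖)) * ‖hmc.toLp _‖ := by ring
    rw [this]
    refine Lp.norm_le_mul_norm_of_ae_le_mul ?_
    filter_upwards [(hS y).coeFn_toLp, hmc.coeFn_toLp] with x hx hx'
    rw [hx, hx', norm_mul, mul_comm]
    gcongr
    refine (norm_torusConv_le hC (hint y) x).trans ?_
    gcongr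
    exact integral_norm_le_norm y

end Operators

/-! ### Comparing the weighted and unweighted `L²` spaces -/

section WeightedSpace

variable {d : ℕ} {σ : ℝ} {V W μbar : Torus d → ℝ}

lemma exists_clm_of_measure_le {α : Type*} [MeasurableSpace α] {μ ν : Measure α} {c : ℝ≥0∞}
    (hc : c ≠ (∞ : ℝ≥0∞)) (h : μ ≤ c • ν) : ∃ A : Lp ℂ 2 ν →L[ℂ] Lp ℂ 2 μ, ∀ y, A y =ᵐ[μ] y := by
  have hac : μ ≪ ν := Measure.absolutelyContinuous_of_le_smul h
  -- This real-linear map supplies only the norm bound; complex linearity comes from the pointwise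
  -- description.
  let L : Lp ℂ 2 ν →L[ℝ] Lp ℂ 2 μ := Lp.LpToLpOfMeasureLeSMul hc h
  have hS (y : Lp ℂ 2 ν) : MemLp (y : α → ℂ) 2 μ := (Lp.memLp y).of_measure_le_smul hc h
  refine exists_clm_of_ae (fun y : Lp ℂ 2 ν => (y : α → ℂ)) hS
    (fun y y' => hac.ae_eq (Lp.coeFn_add y y')) (fun a y => hac.ae_eq (Lp.coeFn_smul a y)) ‖L‖
    fun y => ?_
  have e : (hS y).toLp y = L y :=
    Lp.ext ((hS y).coeFn_toLp.trans (Lp.coeFn_LpToLpOfMeasureLeSMul hc h y).symm)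
  rw [e]
  exact L.le_opNorm y

lemma IsStationaryState.measure_bounds (hσ : 0 < σ) (hV : IsCn 2 V) (hW : MemSobolev 2 ∞ W)
    (hμ : IsStationaryState σ V W μbar) :
    ∃ c c' : ℝ≥0∞, c ≠ (∞ : ℝ≥0∞) ∧ c' ≠ (∞ : ℝ≥0∞) ∧ weightedMeasure μbar ≤ c • volume ∧
      volume ≤ c' • weightedMeasure μbar := by
  obtain ⟨a, b, ha, hb, hab⟩ := hμ.exists_bounds hσ hV hW
  refine ⟨(ENNReal.ofReal a)⁻¹, ENNReal.ofReal b, ?_, ENNReal.ofReal_ne_top, ?_, ?_⟩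
  · simpa using ha
  · rw [weightedMeasure, ← withDensity_const]
    refine withDensity_mono ?_
    filter_upwards [hab] with x hx
    exact ENNReal.inv_le_inv.2 (ENNReal.ofReal_le_ofReal hx.1)
  · rw [weightedMeasure, ← withDensity_smul' _ _ ENNReal.ofReal_ne_top]
    conv_lhs => rw [← withDensity_one (μ := (volume : Measure (Torus d)))]
    refine withDensity_mono ?_
    filter_upwards [hab] with x hx
    have h1 : ENNReal.ofReal b * (ENNReal.ofReal b)⁻¹ = 1 :=
      ENNReal.mul_inv_cancel (by simpa using hb) ENNReal.ofReal_ne_top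
    rw [Pi.one_apply, Pi.smul_apply, smul_eq_mul, ← h1]
    gcongr
    exact hx.2

/-- The weighted space `𝒳` and `L²(𝕋^d)` agree up to equivalence of norms. -/
lemma IsStationaryState.exists_equiv (hσ : 0 < σ) (hV : IsCn 2 V) (hW : MemSobolev 2 ∞ W)
    (hμ : IsStationaryState σ V W μbar) :
    ∃ (Φ : WeightedL2 μbar →L[ℂ] TorusL2 d) (Ψ : TorusL2 d →L[ℂ] WeightedL2 μbar),
      (∀ f, Φ f =ᵐ[volume] f) ∧ (∀ y, Ψ y =ᵐ[volume] y) ∧ ∀ f, Ψ (Φ f) = f := by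
  obtain ⟨c, c', hc, hc', h1, h2⟩ := hμ.measure_bounds hσ hV hW
  obtain ⟨Φ, hΦ⟩ := exists_clm_of_measure_le hc' h2
  obtain ⟨Ψ, hΨ⟩ := exists_clm_of_measure_le hc h1
  have hac := Measure.absolutelyContinuous_of_le_smul h1
  have hac' := Measure.absolutelyContinuous_of_le_smul h2
  exact ⟨Φ, Ψ, hΦ, fun y => hac'.ae_eq (hΨ y),
    fun f => Lp.ext ((hΨ _).trans (hac.ae_eq (hΦ f)))⟩

end WeightedSpace

/-! ### The resolvent of `σΔ` and its perturbation -/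

section Resolvent

variable {d : ℕ} {σ : ℝ} {V W μbar : Torus d → ℝ}

lemma hasWeakDiv_of_hasWeakPartial {E : Type*} [NormedAddCommGroup E] [NormedSpace ℝ E]
    {F f : Fin d → Torus d → E} (h : ∀ i, HasWeakPartial i (F i) (f i)) :
    HasWeakDiv F (fun x => ∑ i, f i x) := by
  refine ⟨fun i => (h i).1, integrable_finsetSum _ fun i _ => (h i).2.1, fun φ hφ => ?_⟩
  have hφ1 : IsCn 1 φ := hφ.of_le (by norm_num)
  simp_rw [Finset.smul_sum]
  rw [integral_finsetSum _ fun i _ => integrable_smul_of_continuous hφ.continuous (h i).2.1,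
    integral_finsetSum _ fun i _ =>
      integrable_smul_of_continuous (hφ1.continuous_torusPartial le_rfl i) (h i).1,
    ← Finset.sum_neg_distrib]
  exact Finset.sum_congr rfl fun i _ => (h i).2.2 φ hφ

/-- The multipliers `R = (z - σΔ)⁻¹`, `D i = ∂_i R` and `D₂ i j = ∂_i ∂_j R`. -/
structure IsLaplaceResolvent (σ : ℝ) (z : ℂ) (R : TorusL2 d →L[ℂ] TorusL2 d)
    (D : Fin d → TorusL2 d →L[ℂ] TorusL2 d) (D₂ : Fin d → Fin d → TorusL2 d →L[ℂ] TorusL2 d) :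
    Prop where
  ne_zero : ∀ k : Fin d → ℤ, resolventSymbol σ z k ≠ 0
  resolvent : IsFourierMultiplier (fun k => (resolventSymbol σ z k)⁻¹) R
  first : ∀ i, IsFourierMultiplier (fun k => Complex.I * k i * (resolventSymbol σ z k)⁻¹) (D i)
  second : ∀ i j, IsFourierMultiplier
    (fun k => Complex.I * k i * (Complex.I * k j * (resolventSymbol σ z k)⁻¹)) (D₂ i j)

lemma exists_isLaplaceResolvent (hσ : 0 < σ) {z : ℂ} {ε : ℝ}
    (h : ∀ k : Fin d → ℤ, 1 ≤ ε * ‖resolventSymbol σ z k‖ ∧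
      ∀ i, |(k i : ℝ)| ≤ ε * ‖resolventSymbol σ z k‖) :
    ∃ R D D₂, IsLaplaceResolvent (d := d) σ z R D D₂ ∧ ‖R‖ ≤ ε ∧ (∀ i, ‖D i‖ ≤ ε) ∧
      IsCompactOperator R := by
  have hpos (k : Fin d → ℤ) : 0 < ‖resolventSymbol σ z k‖ := by
    refine (norm_nonneg _).lt_of_ne fun h0 => ?_
    have := (h k).1
    rw [← h0] at this
    norm_num at this
  have b0 (k : Fin d → ℤ) : ‖(resolventSymbol σ z k)⁻¹‖ ≤ ε := by
    rw [norm_inv, inv_le_iff_one_le_mul₀ (hpos k)]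
    exact (h k).1
  have b1 (i : Fin d) (k : Fin d → ℤ) :
      ‖Complex.I * k i * (resolventSymbol σ z k)⁻¹‖ ≤ ε := by
    rw [norm_mul, norm_mul, Complex.norm_I, one_mul, norm_inv, ← div_eq_mul_inv,
      div_le_iff₀ (hpos k), Complex.norm_intCast]
    exact (h k).2 i
  -- Second derivatives need only be bounded, not small: this puts the range of `R` in `H²`. The
  -- constant comes from `σ|k|² ≤ ‖symbol‖ + ‖z‖` and `1 ≤ ε‖symbol‖`.
  have b2 (i j : Fin d) (k : Fin d → ℤ) :
      ‖Complex.I * k i * (Complex.I * k j * (resolventSymbol σ z k)⁻¹)‖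
        ≤ (1 + ‖z‖ * ε) / σ := by
    set q : ℝ := ∑ i, (k i : ℝ) ^ 2 with hq
    have hq0 : 0 ≤ q := Finset.sum_nonneg fun i _ => sq_nonneg _
    have hk (i : Fin d) : |(k i : ℝ)| ^ 2 ≤ q := by
      rw [sq_abs]
      exact Finset.single_le_sum (f := fun i => (k i : ℝ) ^ 2) (fun i _ => sq_nonneg _)
        (Finset.mem_univ i)
    have hkk : |(k i : ℝ)| * |(k j : ℝ)| ≤ q := by
      nlinarith [hk i, hk j, sq_nonneg (|(k i : ℝ)| - |(k j : ℝ)|)]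
    have hqs : σ * q ≤ ‖resolventSymbol σ z k‖ + ‖z‖ := by
      have e : ((σ * q : ℝ) : ℂ) = resolventSymbol σ z k - z := by
        simp [resolventSymbol, hq]
      rw [← Real.norm_of_nonneg (mul_nonneg hσ.le hq0), ← Complex.norm_real, e]
      exact norm_sub_le _ _
    have hz : ‖z‖ ≤ ‖z‖ * (ε * ‖resolventSymbol σ z k‖) :=
      le_mul_of_one_le_right (norm_nonneg z) (h k).1
    simp only [norm_mul, Complex.norm_I, one_mul, norm_inv, Complex.norm_intCast]
    rw [← mul_assoc, ← div_eq_mul_inv, div_le_div_iff₀ (hpos k) hσ]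
    nlinarith
  obtain ⟨R, hR, hRn⟩ := exists_isFourierMultiplier b0
  choose D hD hDn using fun i => exists_isFourierMultiplier (b1 i)
  choose D₂ hD₂ hD₂n using fun i j => exists_isFourierMultiplier (b2 i j)
  exact ⟨R, D, D₂, ⟨fun k => norm_pos_iff.1 (hpos k), hR, hD, hD₂⟩, hRn, hDn,
    hR.isCompactOperator (tendsto_inv_symbol h)⟩

variable {z : ℂ} {R : TorusL2 d →L[ℂ] TorusL2 d} {D : Fin d → TorusL2 d →L[ℂ] TorusL2 d}
  {D₂ : Fin d → Fin d → TorusL2 d →L[ℂ] TorusL2 d}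

lemma IsLaplaceResolvent.hasWeakPartial (h : IsLaplaceResolvent σ z R D D₂) (i : Fin d)
    (f : TorusL2 d) : HasWeakPartial i (R f : Torus d → ℂ) (D i f) :=
  hasWeakPartial_of_repr fun k => by rw [h.first i f k, h.resolvent f k]; ring

lemma IsLaplaceResolvent.hasWeakPartial_second (h : IsLaplaceResolvent σ z R D D₂) (i j : Fin d)
    (f : TorusL2 d) : HasWeakPartial i (D j f : Torus d → ℂ) (D₂ i j f) :=
  hasWeakPartial_of_repr fun k => by rw [h.second i j f k, h.first j f k]; ring

lemma IsLaplaceResolvent.memSobolev (h : IsLaplaceResolvent σ z R D D₂) (f : TorusL2 d) :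
    MemSobolev 2 2 (R f : Torus d → ℂ) :=
  ⟨Lp.memLp _, fun j => ⟨D j f, h.hasWeakPartial j f, Lp.memLp _,
    fun i => ⟨D₂ i j f, h.hasWeakPartial_second i j f, Lp.memLp _⟩⟩⟩

lemma resolventSymbol_eq (k : Fin d → ℤ) :
    resolventSymbol σ z k = z - σ * ∑ i, (Complex.I * k i) * (Complex.I * k i) := by
  have e : ∀ i, (Complex.I * k i) * (Complex.I * k i) = -((k i : ℂ) ^ 2) := fun i => by
    linear_combination ((k i : ℂ) ^ 2) * Complex.I_mul_I
  simp_rw [e, resolventSymbol, Finset.sum_neg_distrib]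
  push_cast
  ring

lemma repr_sum_apply {ι : Type*} (s : Finset ι) (f : ι → TorusL2 d) (k : Fin d → ℤ) :
    (modeBasis d).repr (∑ i ∈ s, f i) k = ∑ i ∈ s, (modeBasis d).repr (f i) k := by
  rw [map_sum, lp.coeFn_sum, Finset.sum_apply]

/-- This is `(z - σΔ) R = 1`, read off symbol by symbol. -/
lemma IsLaplaceResolvent.laplacian (h : IsLaplaceResolvent σ z R D D₂) (f : TorusL2 d) :
    (σ : ℂ) • ∑ i, D₂ i i f = z • R f - f := by
  refine ext_repr fun k => ?_
  rw [map_smul, map_sub, map_smul, lp.coeFn_smul, lp.coeFn_sub, lp.coeFn_smul, Pi.smul_apply,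
    Pi.sub_apply, Pi.smul_apply, repr_sum_apply]
  simp_rw [h.second _ _ f k]
  rw [h.resolvent f k]
  have h1 := h.ne_zero k
  have h2 := resolventSymbol_eq (σ := σ) (z := z) k
  have h3 : ∑ i, Complex.I * (k i : ℂ) * (Complex.I * k i * (resolventSymbol σ z k)⁻¹)
        * (modeBasis d).repr f k
      = (∑ i, (Complex.I * (k i : ℂ)) * (Complex.I * k i)) *
        ((resolventSymbol σ z k)⁻¹ * (modeBasis d).repr f k) := by
    rw [Finset.sum_mul]
    exact Finset.sum_congr rfl fun i _ => by ring
  rw [h3, smul_eq_mul, smul_eq_mul]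
  have h4 : (σ : ℂ) * ∑ i, (Complex.I * (k i : ℂ)) * (Complex.I * k i)
      = z - resolventSymbol σ z k := by rw [h2]; ring
  rw [← mul_assoc, h4]
  field_simp

/-- The preimage is `z y - σΔy`. Having all of `H²` in the range of `R` is what makes the inverse of
`z - 𝓛` two-sided. -/
lemma IsLaplaceResolvent.exists_eq (h : IsLaplaceResolvent σ z R D D₂) {y : TorusL2 d}
    (hy : MemSobolev 2 2 (y : Torus d → ℂ)) : ∃ f, y = R f := by
  have h1 (i : Fin d) : MemLp (weakPartial i (y : Torus d → ℂ)) 2 volume := hy.memLp_weakPartial i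
  have h2 (i : Fin d) : MemLp (weakPartial i (weakPartial i (y : Torus d → ℂ))) 2 volume :=
    (memSobolev_weakPartial hy i).memLp_weakPartial i
  have w1 (i : Fin d) : HasWeakPartial i (y : Torus d → ℂ) ((h1 i).toLp _) :=
    (hy.hasWeakPartial i).congr_right (h1 i).coeFn_toLp.symm
  have w2 (i : Fin d) : HasWeakPartial i ((h1 i).toLp _ : Torus d → ℂ) ((h2 i).toLp _) :=
    (((memSobolev_weakPartial hy i).hasWeakPartial i).congr (h1 i).coeFn_toLp.symm).congr_right
      (h2 i).coeFn_toLp.symm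
  refine ⟨z • y - (σ : ℂ) • ∑ i, (h2 i).toLp _, ext_repr fun k => ?_⟩
  rw [h.resolvent, map_sub, map_smul, map_smul, lp.coeFn_sub, lp.coeFn_smul, lp.coeFn_smul,
    Pi.sub_apply, Pi.smul_apply, Pi.smul_apply, repr_sum_apply]
  simp_rw [(w2 _).repr k, (w1 _).repr k]
  have h1 := h.ne_zero k
  rw [eq_inv_mul_iff_mul_eq₀ h1, resolventSymbol_eq, smul_eq_mul, smul_eq_mul, sub_mul, mul_assoc,
    Finset.sum_mul]
  congr 2
  exact Finset.sum_congr rfl fun i _ => by ring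

/-- The lower order part of the linearized operator: `B₁ i` acts on `∂_i y` and `B₀` on `y`. -/
structure IsLowerOrderPart (V W μbar : Torus d → ℝ) (B₀ : TorusL2 d →L[ℂ] TorusL2 d)
    (B₁ : Fin d → TorusL2 d →L[ℂ] TorusL2 d) : Prop where
  first : ∀ i y, B₁ i y =ᵐ[volume] fun x => (gradPotential V W μbar i x : ℂ) * y x
  zeroth : ∀ y : TorusL2 d, B₀ y =ᵐ[volume] fun x => ∑ i, ((hessPotential V W μbar i x : ℂ) * y x
    + (((weakPartial i μbar x : ℝ) : ℂ) * torusConv (weakPartial i W) y x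
      + (μbar x : ℂ) * torusConv (weakPartial i (weakPartial i W)) y x))

lemma coeFn_sum_apply {α ι : Type*} [MeasurableSpace α] {μ : Measure α} (s : Finset ι)
    (f : ι → Lp ℂ 2 μ) : (∑ i ∈ s, f i : Lp ℂ 2 μ) =ᵐ[μ] fun x => ∑ i ∈ s, f i x := by
  classical
  induction s using Finset.induction_on with
  | empty =>
    simp only [Finset.sum_empty]
    exact Lp.coeFn_zero ℂ 2 μ
  | insert a s ha ih =>
    rw [Finset.sum_insert ha]
    filter_upwards [Lp.coeFn_add (f a) (∑ i ∈ s, f i), ih] with x hx hx'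
    rw [hx, Pi.add_apply, hx', Finset.sum_insert ha]

lemma exists_isLowerOrderPart (hV : IsCn 2 V) (hW : MemSobolev 2 ∞ W)
    (hμ : MemSobolev 1 2 μbar) : ∃ B₀ B₁, IsLowerOrderPart V W μbar B₀ B₁ := by
  choose B₁ hB₁ using fun i => exists_clm_mul (memLp_top_gradPotential hV hW hμ.integrable i)
  choose A hA using fun i => exists_clm_mul (memLp_top_hessPotential hV hW hμ.integrable i)
  choose A' hA' using fun i =>
    exists_clm_mul_torusConv (hμ.memLp_weakPartial i) (hW.memLp_weakPartial i)
  choose A'' hA'' using fun i =>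
    exists_clm_mul_torusConv hμ.memLp ((memSobolev_weakPartial hW i).memLp_weakPartial i)
  refine ⟨∑ i, (A i + (A' i + A'' i)), B₁, hB₁, fun y => ?_⟩
  have e : (∑ i, (A i + (A' i + A'' i)) : TorusL2 d →L[ℂ] TorusL2 d) y
      = ∑ i, (A i y + (A' i y + A'' i y)) := by
    rw [sum_apply]
    rfl
  rw [e]
  refine (coeFn_sum_apply _ _).trans ?_
  have h1 (i : Fin d) := Lp.coeFn_add (A i y) (A' i y + A'' i y)
  have h2 (i : Fin d) := Lp.coeFn_add (A' i y) (A'' i y)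
  filter_upwards [ae_all_iff.2 h1, ae_all_iff.2 h2, ae_all_iff.2 fun i => hA i y,
    ae_all_iff.2 fun i => hA' i y, ae_all_iff.2 fun i => hA'' i y] with x x1 x2 x3 x4 x5
  refine Finset.sum_congr rfl fun i _ => ?_
  rw [x1, Pi.add_apply, x2, Pi.add_apply, x3, x4, x5]

variable {B₀ : TorusL2 d →L[ℂ] TorusL2 d} {B₁ : Fin d → TorusL2 d →L[ℂ] TorusL2 d}

/-- The linearized operator on the range of `(z - σΔ)⁻¹`. -/
lemma IsLaplaceResolvent.hasWeakDiv (h : IsLaplaceResolvent σ z R D D₂)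
    (hB : IsLowerOrderPart V W μbar B₀ B₁) (hV : IsCn 2 V) (hW : MemSobolev 2 ∞ W)
    (hμ : MemSobolev 1 2 μbar) (f : TorusL2 d) :
    HasWeakDiv (linearizedFlux σ V W μbar (R f : Torus d → ℂ))
      (z • R f - (f - ((∑ i, B₁ i ∘L D i) + B₀ ∘L R) f) : TorusL2 d) := by
  have hy2 := Lp.memLp (R f)
  have hyi := integrable_of_memLp_two hy2
  have c2 {u : Torus d → ℝ} (hu : MemLp u 2 volume) :
      MemLp (fun x => (u x : ℂ)) 2 volume := hu.ofReal
  -- Product rule in each flux component, with the derivative of the convolution placed on `W`.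
  have hpart (i : Fin d) : HasWeakPartial i
      ((fun x => (σ : ℂ) * D i f x) + ((fun x => (gradPotential V W μbar i x : ℂ) * R f x)
        + fun x => (μbar x : ℂ) * torusConv (weakPartial i W) (R f : Torus d → ℂ) x))
      ((fun x => (σ : ℂ) * D₂ i i f x) + ((fun x => (hessPotential V W μbar i x : ℂ) * R f x
          + (gradPotential V W μbar i x : ℂ) * D i f x)
        + fun x => ((weakPartial i μbar x : ℝ) : ℂ) * torusConv (weakPartial i W) (R f : Torus d → ℂ) x
          + (μbar x : ℂ) * torusConv (weakPartial i (weakPartial i W)) (R f : Torus d → ℂ) x)) := by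
    refine ((h.hasWeakPartial_second i i f).const_smul (σ : ℂ)).add (HasWeakPartial.add ?_ ?_)
    · exact HasWeakPartial.mul_complex
        (c2 (memLp_two_of_memLp_top (memLp_top_gradPotential hV hW hμ.integrable i)))
        (c2 (memLp_two_of_memLp_top (memLp_top_hessPotential hV hW hμ.integrable i)))
        hy2 (Lp.memLp (D i f))
        (hasWeakPartial_ofReal.2 (hasWeakPartial_gradPotential hV hW hμ.integrable i))
        (h.hasWeakPartial i f)
    · have hk := hW.memLp_weakPartial i
      have hkk := (memSobolev_weakPartial hW i).memLp_weakPartial i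
      exact HasWeakPartial.mul_complex (c2 hμ.memLp) (c2 (hμ.memLp_weakPartial i))
        (memLp_two_of_memLp_top (memLp_top_torusConv hk hyi))
        (memLp_two_of_memLp_top (memLp_top_torusConv hkk hyi))
        (hasWeakPartial_ofReal.2 (hμ.hasWeakPartial i))
        (((memSobolev_weakPartial hW i).hasWeakPartial i).torusConv hk hkk hyi)
  refine (hasWeakDiv_of_hasWeakPartial hpart).congr (fun i => ?_) ?_
  · filter_upwards [weakPartial_ae_eq (h.hasWeakPartial i f)] with x hx
    simp only [linearizedFlux, hx, Pi.add_apply, Complex.real_smul]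
    ring
  · have e : (z • R f - (f - ((∑ i, B₁ i ∘L D i) + B₀ ∘L R) f) : TorusL2 d)
        = (∑ i, ((σ : ℂ) • D₂ i i f + B₁ i (D i f))) + B₀ (R f) := by
      rw [Finset.sum_add_distrib, ← Finset.smul_sum, h.laplacian, add_apply, sum_apply]
      simp only [ContinuousLinearMap.comp_apply]
      abel
    rw [e]
    have h1 := Lp.coeFn_add (∑ i, ((σ : ℂ) • D₂ i i f + B₁ i (D i f))) (B₀ (R f))
    have h2 := coeFn_sum_apply Finset.univ fun i => (σ : ℂ) • D₂ i i f + B₁ i (D i f)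
    have h3 (i : Fin d) := Lp.coeFn_add ((σ : ℂ) • D₂ i i f) (B₁ i (D i f))
    have h4 (i : Fin d) := Lp.coeFn_smul (σ : ℂ) (D₂ i i f)
    filter_upwards [h1, h2, ae_all_iff.2 h3, ae_all_iff.2 h4, hB.zeroth (R f),
      ae_all_iff.2 fun i => hB.first i (D i f)] with x x1 x2 x3 x4 x5 x6
    rw [x1, Pi.add_apply, x2, x5, ← Finset.sum_add_distrib]
    refine Finset.sum_congr rfl fun i _ => ?_
    rw [x3]
    simp only [Pi.add_apply, x4, x6, Pi.smul_apply, smul_eq_mul]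
    ring

/-- If `B (z - σΔ)⁻¹` is a contraction, then `z - 𝓛` has a compact inverse. -/
lemma IsLaplaceResolvent.exists_resolvent (hσ : 0 < σ) (h : IsLaplaceResolvent σ z R D D₂)
    (hR : IsCompactOperator R)
    (hB : IsLowerOrderPart V W μbar B₀ B₁) (hV : IsCn 2 V) (hW : MemSobolev 2 ∞ W)
    (hμ : IsStationaryState σ V W μbar)
    (hT : ‖(∑ i, B₁ i ∘L D i) + B₀ ∘L R‖ < 1) :
    ∃ K : WeightedL2 μbar →L[ℂ] WeightedL2 μbar, IsCompactOperator K ∧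
      (∀ f, (K f, z • K f - f) ∈ (linearizedOperator σ V W μbar hW hμ).graph) ∧
      ∀ p ∈ (linearizedOperator σ V W μbar hW hμ).graph, K (z • p.1 - p.2) = p.1 := by
  set T := (∑ i, B₁ i ∘L D i) + B₀ ∘L R with hTdef
  -- Neumann series; `N = (1 - T)⁻¹`, and the inverse of `z - 𝓛` is `R N` conjugated by the
  -- identification of the two `L²` spaces.
  obtain ⟨u, hu⟩ := isUnit_one_sub_of_norm_lt_one hT
  obtain ⟨Φ, Ψ, hΦ, hΨ, hΨΦ⟩ := hμ.exists_equiv hσ hV hW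
  have hac := volume_absolutelyContinuous hμ
  let N : TorusL2 d →L[ℂ] TorusL2 d := ↑u⁻¹
  have hTN (f : TorusL2 d) : N f - T (N f) = f := by
    have := congrArg (fun A : TorusL2 d →L[ℂ] TorusL2 d => A f) u.mul_inv
    rw [hu] at this
    exact this
  have hNT (f : TorusL2 d) : N (f - T f) = f := by
    have := congrArg (fun A : TorusL2 d →L[ℂ] TorusL2 d => A f) u.inv_mul
    rw [hu] at this
    exact this
  rw [linearizedOperator_graph]
  refine ⟨Ψ ∘L R ∘L N ∘L Φ, ?_, fun f => ?_, ?_⟩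
  · exact (hR.comp_clm (N ∘L Φ)).clm_comp Ψ
  · set y := R (N (Φ f)) with hy
    have h1 := h.hasWeakDiv hB hV hW hμ.memSobolev (N (Φ f))
    rw [← hTdef, hTN, ← hy] at h1
    have hS : MemSobolev 2 2 (y : Torus d → ℂ) := h.memSobolev _
    have hΨy : (y : Torus d → ℂ) =ᵐ[volume] Ψ y := (hΨ y).symm
    refine ⟨hS.congr hΨy, h1.congr (fun i => linearizedFlux_congr hS.of_succ hΨy i) ?_⟩
    change _ =ᵐ[volume] ((z • Ψ y - f : WeightedL2 μbar) : Torus d → ℂ)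
    filter_upwards [Lp.coeFn_sub (z • y) (Φ f), Lp.coeFn_smul z y, hΦ f, hΨ y,
      hac.ae_eq (Lp.coeFn_sub (z • Ψ y) f), hac.ae_eq (Lp.coeFn_smul z (Ψ y))]
      with x x1 x2 x3 x4 x5 x6
    rw [x1, x5, Pi.sub_apply, Pi.sub_apply, x2, x6, x3, Pi.smul_apply, Pi.smul_apply, x4]
  · rintro ⟨p, g⟩ ⟨hp, hdiv⟩
    have hpΦ : (p : Torus d → ℂ) =ᵐ[volume] Φ p := (hΦ p).symm
    -- Once `p = R f`, uniqueness of the weak divergence gives `z p - g = (1 - T) f`, and applying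
    -- `R N` returns `p`.
    obtain ⟨f, hf⟩ := h.exists_eq (hp.congr hpΦ)
    have h1 := h.hasWeakDiv hB hV hW hμ.memSobolev f
    rw [← hTdef, ← hf] at h1
    have h2 := hdiv.congr (fun i => linearizedFlux_congr hp.of_succ hpΦ i) (ae_eq_refl _)
    have h3 := h2.unique h1
    have h4 : Φ g = z • Φ p - (f - T f) := Lp.ext ((hΦ g).trans h3)
    change Ψ (R (N (Φ (z • p - g)))) = p
    rw [map_sub, map_smul, h4, sub_sub_cancel, hNT, ← hf, hΨΦ]

end Resolvent

end McKeanVlasov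

/-! ### Confinement to a ball and discreteness -/

theorem mainTheorem7 {d : ℕ} {σ : ℝ} (hσ : 0 < σ) {V W : McKeanVlasov.Torus d → ℝ}
    (hV : McKeanVlasov.IsCn 2 V) (hW : McKeanVlasov.MemSobolev 2 ∞ W)
    (hWeven : ∀ᵐ x, W (-x) = W x)
    {μbar : McKeanVlasov.Torus d → ℝ} (hμ : McKeanVlasov.IsStationaryState σ V W μbar)
    {δ : ℝ} (hδ : 0 < δ) :
    {z ∈ McKeanVlasov.opSpectrum (McKeanVlasov.linearizedOperator σ V W μbar hW hμ) |
      -δ ≤ z.re}.Finite := by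
  obtain ⟨B₀, B₁, hB⟩ := McKeanVlasov.exists_isLowerOrderPart hV hW hμ.memSobolev
  set M : ℝ := (∑ i, ‖B₁ i‖) + ‖B₀‖ with hM
  have hM0 : 0 ≤ M := by positivity
  -- Since `‖T‖ ≤ M ε`, this choice makes `T` a strict contraction.
  set ε : ℝ := (M + 1)⁻¹ with hε
  have hε0 : 0 < ε := by positivity
  obtain ⟨ρ, hρ⟩ := McKeanVlasov.exists_symbol_bound (d := d) hσ hδ hε0
  have key (z : ℂ) (hz : -δ ≤ z.re) (hzρ : ρ ≤ ‖z‖) :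
      ∃ K : McKeanVlasov.WeightedL2 μbar →L[ℂ] McKeanVlasov.WeightedL2 μbar,
        IsCompactOperator K ∧
        (∀ f, (K f, z • K f - f) ∈
          (McKeanVlasov.linearizedOperator σ V W μbar hW hμ).graph) ∧
        ∀ p ∈ (McKeanVlasov.linearizedOperator σ V W μbar hW hμ).graph,
          K (z • p.1 - p.2) = p.1 := by
    obtain ⟨R, D, D₂, hR, hRn, hDn, hRc⟩ :=
      McKeanVlasov.exists_isLaplaceResolvent hσ (hρ z hz hzρ)
    refine hR.exists_resolvent hσ hRc hB hV hW hμ ?_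
    have h1 : ‖(∑ i, B₁ i ∘L D i) + B₀ ∘L R‖ ≤ M * ε := by
      refine (norm_add_le _ _).trans ?_
      rw [hM, add_mul, Finset.sum_mul]
      refine add_le_add ((norm_sum_le _ _).trans (Finset.sum_le_sum fun i _ => ?_)) ?_
      · refine (ContinuousLinearMap.opNorm_comp_le _ _).trans ?_
        gcongr
        exact hDn i
      · refine (ContinuousLinearMap.opNorm_comp_le _ _).trans ?_
        gcongr
    refine h1.trans_lt ?_
    rw [hε, ← div_eq_mul_inv, div_lt_one (by positivity)]
    linarith
  -- A base point for the compact resolvent: a nonnegative real number of modulus at least `ρ`. The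
  -- maximum is taken because the sign of `ρ` is unknown.
  obtain ⟨K, hK, hK1, hK2⟩ := key ((max ρ 0 : ℝ) : ℂ)
    (by rw [Complex.ofReal_re]; exact (neg_nonpos.2 hδ.le).trans (le_max_right _ _))
    (by rw [Complex.norm_real, Real.norm_of_nonneg (le_max_right _ _)]; exact le_max_left _ _)
  refine (McKeanVlasov.finite_opSpectrum_inter_of_isCompactOperator hK hK1 hK2
    (Metric.isBounded_ball (x := (0 : ℂ)) (r := ρ))).subset ?_
  rintro z ⟨hz, hzδ⟩
  refine ⟨hz, ?_⟩
  rw [mem_ball_zero_iff]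
  by_contra hn
  obtain ⟨K', -, h1, h2⟩ := key z hzδ (not_lt.1 hn)
  exact hz (McKeanVlasov.mem_opResolventSet_of_graph K' h1 h2)
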